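/- **Setting.** Let $M$ be an episodic Markov decision process with horizon $H\ge 1$, state space $\mathcal S$ (an arbitrary set), finite non-empty action set $\mathcal A$, fixed initial state $s_1$, discrete transition probabilities $P_h(\cdot\mid s,a)$ on $\mathcal S$, and deterministic rewards $r_h(s,a)\ge 0$ with $\sum_{h=1}^H r_h\le 1$ along every possible episode. A policy is a sequence $\pi=(\pi_h)_{h=1}^{H}$ of maps $\mathcal S\to\mathcal A$; $V^\pi_h,Q^\pi_h$ are its value functions, $V^\star_h=\sup_\pi V_h^\pi$, $Q^\star_h=\sup_\pi Q_h^\pi$, and $\rho^\pi_h(s,a)=\Pr^\pi[s_h=s,a_h=a]$. Put $(\mathcal T_h f)(s,a)=r_h(s,a)+\mathbb E_{s'\sim P_h(\cdot\mid s,a)}\max_{a'}f(s',a')$. For a policy class $\Pi$, a real $p\ge 1$ and probability distributions $\mu=(\mu_h)_{h=1}^H$ on $\mathcal S\times\mathcal A$, the $L^p$ coverability coefficient is $$C_{\tt cw}=\inf_{\mu_1,\dots,\mu_H}\ \sup_{\pi\in\Pi,\,h\le H}\Big\|\frac{\rho_h^\pi}{\mu_h}\Big\|^p_{L^p(d\mu_h)},\qquad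 \Big\|\frac{\rho}{\mu}\Big\|^p_{L^p(d\mu)}=\sum_{s,a}\mu(s,a)\Big(\frac{\rho(s,a)}{\mu(s,a)}\Big)^p,$$ where the norm is $+\infty$ if $\rho\not\ll\mu$. Assume that $\mu=(\mu_h)$ attains the infimum and that $\sum_{s,a}\sqrt{\mu_h(s,a)}<\infty$ for every $h$. Let $\mathcal F=\mathcal F_1\times\dots\times\mathcal F_H$ with $\mathcal F_h$ a set of functions $\mathcal S\times\mathcal A\to[0,1]$, with the convention $f_{H+1}=0$, $\mathcal F_{H+1}=\{0\}$. Assume *realizability* ($Q^\star_h\in\mathcal F_h$ for all $h\in[H]$) and *Bellman completeness* ($\mathcal T_h f\in\mathcal F_h$ for all $f\in\mathcal F_{h+1}$, $h\in[H]$). For $f\in\mathcal F$ let $\pi^f$ be a greedy policy, $\pi^f_h(s)\in\arg\max_a f_h(s,a)$ (ties broken by a fixed arbitrary rule), and assume $\pi^f\in\Pi$ for all $f\in\mathcal F$. Let $\mathscr N_{\mathcal F}(\epsilon)$ be the minimal number of balls of radius $\epsilon$ in the supremum norm (over $h,s,a$) that cover $\mathcal F$. **GOLF** with parameter $\beta$: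 in episode $t=1,\dots,T$ choose $f^t\in\arg\max_{f\in\mathcal F^{(t-1)}}f_1(s_1,\pi^f_1(s_1))$, run $\pi^t=\pi^{f^t}$ for one episode, and add each $(s_h^t,a_h^t,r_h^t,s_{h+1}^t)$ to the data set $\mathcal D_h^{(t)}$ of step $h$. Here $\mathcal F^{(0)}=\mathcal F$ and $$\mathcal F^{(t)}=\Big\{f\in\mathcal F:\ \mathcal L_h^{(t)}(f_h,f_{h+1})-\inf_{g\in\mathcal F_h}\mathcal L^{(t)}_h(g,f_{h+1})\le\beta\ \ \forall h\in[H]\Big\},$$ $$\mathcal L_h^{(t)}(f,f')=\sum_{(s,a,r,s')\in\mathcal D_h^{(t)}}\big(f(s,a)-r-\max_{a'}f'(s',a')\big)^2 .$$ The regret is $\mathtt{Regret}(T)=\sum_{t=1}^T\big(V^\star_1(s_1)-V^{\pi^t}_1(s_1)\big)$. **Claim.** There are absolute constants $c,K>0$ such that for all $M$, $\Pi$, $p\ge1$ and $\mu$ as above there is a number $L$, depending only on $(M,\Pi,p,\mu)$, with $$L\le K\Big(\max_{h\le H}\sum_{s,a}\mu_h(s,a)^{\min\{1/2,\;1-1/p\}}\Big)^{1/2}$$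 whenever the right-hand side is finite (for $p\ge 2$ it always is, and it equals $K\max_h(\sum_{s,a}\sqrt{\mu_h(s,a)})^{1/2}$), and such that the following holds. For every $\mathcal F$ and every choice of greedy policies as above, every $T\ge2$ with $\mathscr N_{\mathcal F}(1/T)<\infty$ and every $\delta\in(0,1)$, if GOLF is run for $T$ episodes with $\beta=c\log\big(\mathscr N_{\mathcal F}(1/T)\,T\,H/\delta\big)$, then with probability at least $1-\delta$, $$\mathtt{Regret}(T)\ \le\ L\cdot H\sqrt{C_{\tt cw}^{1/p}\,\beta\,T\log T}.$$ -/

import Mathlib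

open scoped ENNReal NNReal

universe u v

noncomputable section

namespace RL

/-- One recorded step `(s_h, a_h, r_h, s_{h+1})` of an episode. -/
structure Step (S : Type u) (A : Type v) where
  state : S
  action : A
  reward : ℝ
  next : S

/-- A non-stationary deterministic policy. Steps are numbered `0, …, H - 1` throughout; only the
components below the horizon matter. -/
abbrev Policy (S : Type u) (A : Type v) := ℕ → S → A

/-- A sequence of action-value functions, indexed by the step. -/
abbrev QFun (S : Type u) (A : Type v) := ℕ → S → A → ℝ

/-- The data of an episodic Markov decision problem with horizon `H`, fixed initial state, transition
probabilities `P h s a` and deterministic rewards `r h s a`. -/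
structure EpisodicMDP (S : Type u) (A : Type v) where
  H : ℕ
  init : S
  P : ℕ → S → A → PMF S
  r : ℕ → S → A → ℝ

namespace EpisodicMDP

variable {S : Type u} {A : Type v} (M : EpisodicMDP S A)

/-- The law of the next `n` steps when action `a` is taken in state `s` at step `h`, and the
policy `π` is followed afterwards. -/
def rollout (π : Policy S A) : ℕ → ℕ → S → A → PMF (List (Step S A))
  | 0, _, _, _ => PMF.pure []
  | n + 1, h, s, a =>
      (M.P h s a).bind fun s' =>
        (rollout π n (h + 1) s' (π (h + 1) s')).map fun l => ⟨s, a, M.r h s a, s'⟩ :: l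

/-- The law of a whole episode under the policy `π`. -/
def episode (π : Policy S A) : PMF (List (Step S A)) :=
  M.rollout π M.H 0 M.init (π 0 M.init)

/-- The total reward collected along a list of steps. -/
def totalReward (l : List (Step S A)) : ℝ := (l.map Step.reward).sum

/-- The action-value function `Q_h^π(s, a)`: expected total reward from step `h` on. -/
def Q (π : Policy S A) (h : ℕ) (s : S) (a : A) : ℝ :=
  ∑' l, (M.rollout π (M.H - h) h s a l).toReal * totalReward l

/-- The state-value function `V_h^π(s)`. -/
def V (π : Policy S A) (h : ℕ) (s : S) : ℝ := M.Q π h s (π h s)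

/-- The optimal action-value function. -/
def Qstar (h : ℕ) (s : S) (a : A) : ℝ := ⨆ π : Policy S A, M.Q π h s a

/-- The optimal state-value function. -/
def Vstar (h : ℕ) (s : S) : ℝ := ⨆ π : Policy S A, M.V π h s

/-- The occupancy measure `ρ_h^π(s, a) = Pr^π[s_h = s, a_h = a]`. -/
def occupancy (π : Policy S A) (h : ℕ) (x : S × A) : ℝ≥0∞ :=
  (M.episode π).toOuterMeasure {l | ∃ e, l[h]? = some e ∧ e.state = x.1 ∧ e.action = x.2}

/-- The Bellman operator `(T_h f)(s, a) = r_h(s, a) + E_{s' ∼ P_h(· | s, a)} max_{a'} f(s', a')`. -/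
def bellman (h : ℕ) (f : S → A → ℝ) (s : S) (a : A) : ℝ :=
  M.r h s a + ∑' s', (M.P h s a s').toReal * ⨆ a', f s' a'

/-- Standing conventions: a positive horizon, non-negative rewards, and total reward at most one
along every possible episode. -/
structure Normalized : Prop where
  horizon_pos : 1 ≤ M.H
  reward_nonneg : ∀ h < M.H, ∀ s a, 0 ≤ M.r h s a
  totalReward_le_one : ∀ π : Policy S A, ∀ l ∈ (M.episode π).support, totalReward l ≤ 1

/-- `‖ρ / μ‖^p` in `L^p(dμ)` for weights `ρ`; it is infinite if `ρ` is not absolutely continuous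
with respect to `μ`, that is, if the density `ρ / μ` does not exist. -/
def ratioNorm {X : Type*} (p : ℝ) (ρ : X → ℝ≥0∞) (μ : PMF X) : ℝ≥0∞ :=
  open Classical in
  if ∀ x, μ x = 0 → ρ x = 0 then ∑' x, μ x * (ρ x / μ x) ^ p else ⊤

/-- `sup_{π ∈ Pol, h} ‖ρ_h^π / μ_h‖^p` in `L^p(dμ_h)`. -/
def coverage (Pol : Set (Policy S A)) (p : ℝ) (μ : ℕ → PMF (S × A)) : ℝ≥0∞ :=
  ⨆ π ∈ Pol, ⨆ h < M.H, ratioNorm p (M.occupancy π h) (μ h)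

/-- The `L^p` coverability coefficient of a policy class. -/
def Ccw (Pol : Set (Policy S A)) (p : ℝ) : ℝ≥0∞ :=
  ⨅ μ : ℕ → PMF (S × A), M.coverage Pol p μ

/-- The product class `F_0 × ⋯ × F_{H-1}`, with `f_h = 0` for `h ≥ H`. -/
def classOf (F : ℕ → Set (S → A → ℝ)) : Set (QFun S A) :=
  {f | (∀ h < M.H, f h ∈ F h) ∧ ∀ h, M.H ≤ h → f h = 0}

/-- Every function in every `F_h` takes values in `[0, 1]`. -/
def UnitRange (F : ℕ → Set (S → A → ℝ)) : Prop :=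
  ∀ h < M.H, ∀ f ∈ F h, ∀ s a, f s a ∈ Set.Icc (0 : ℝ) 1

/-- Realizability: `Q_h^⋆ ∈ F_h` for every step. -/
def Realizable (F : ℕ → Set (S → A → ℝ)) : Prop :=
  ∀ h < M.H, M.Qstar h ∈ F h

/-- Bellman completeness: `T_h F_{h+1} ⊆ F_h` for every step, where the class after the last step
is `{0}`. -/
def BellmanComplete (F : ℕ → Set (S → A → ℝ)) : Prop :=
  (∀ h, h + 1 < M.H → ∀ f ∈ F (h + 1), M.bellman h f ∈ F h) ∧
    ∀ h, h + 1 = M.H → M.bellman h 0 ∈ F h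

/-- The covering number of a class of `H`-tuples of functions in the supremum norm (over the steps,
the states and the actions); the centres of the balls are arbitrary functions. -/
def coveringNumber (𝓕 : Set (QFun S A)) (ε : ℝ) : ℕ∞ :=
  ⨅ (C : Finset (QFun S A)) (_ : ∀ f ∈ 𝓕, ∃ g ∈ C, ∀ h < M.H, ∀ s a, |f h s a - g h s a| ≤ ε),
    (C.card : ℕ∞)

/-- `greedy` assigns to each member `f` of the class a policy with
`π_h^f(s) ∈ argmax_a f_h(s, a)`. -/
def IsGreedyRule (𝓕 : Set (QFun S A)) (greedy : QFun S A → Policy S A) : Prop :=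
  ∀ f ∈ 𝓕, ∀ h < M.H, ∀ s a, f h s a ≤ f h s (greedy f h s)

/-- The data set of step `h` contained in a list of episodes. -/
def dataset (D : List (List (Step S A))) (h : ℕ) : List (Step S A) :=
  D.filterMap fun e => e[h]?

/-- The squared loss `∑ (f(s, a) - r - max_{a'} f'(s', a'))²` over a data set. -/
def loss (D : List (Step S A)) (f f' : S → A → ℝ) : ℝ :=
  (D.map fun e => (f e.state e.action - e.reward - ⨆ a', f' e.next a') ^ 2).sum

/-- The confidence set of GOLF. The condition
`L_h(f_h, f_{h+1}) - inf_{g ∈ F_h} L_h(g, f_{h+1}) ≤ β` is written out for every `g`. -/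
def confidenceSet (F : ℕ → Set (S → A → ℝ)) (β : ℝ) (D : List (List (Step S A))) :
    Set (QFun S A) :=
  {f ∈ M.classOf F | ∀ h < M.H, ∀ g ∈ F h,
    loss (dataset D h) (f h) (f (h + 1)) - loss (dataset D h) g (f (h + 1)) ≤ β}

/-- The law of the first `t` episodes when the function for the next episode is chosen as `sel D`
from the past episodes `D`, and its greedy policy is executed. -/
def runLaw (greedy : QFun S A → Policy S A) (sel : List (List (Step S A)) → QFun S A) :
    ℕ → PMF (List (List (Step S A)))
  | 0 => PMF.pure []
  | t + 1 => (runLaw greedy sel t).bind fun D =>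
      (M.episode (greedy (sel D))).map fun e => D ++ [e]

/-- `sel` is the selection rule of GOLF with confidence parameter `β`, run for `T` episodes: after
every history `D` that can occur, `sel D` maximizes `f ↦ f_1(s_1, π_1^f(s_1))` over the confidence
set. Ties may be broken in any way. -/
def IsGOLF (F : ℕ → Set (S → A → ℝ)) (greedy : QFun S A → Policy S A) (β : ℝ) (T : ℕ)
    (sel : List (List (Step S A)) → QFun S A) : Prop :=
  ∀ t < T, ∀ D ∈ (M.runLaw greedy sel t).support,
    sel D ∈ M.confidenceSet F β D ∧
    ∀ f ∈ M.confidenceSet F β D,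
      f 0 M.init (greedy f 0 M.init) ≤ sel D 0 M.init (greedy (sel D) 0 M.init)

/-- The regret of the `T` episodes recorded in `D`; the policy of an episode is the greedy policy
of the function selected from the episodes before it. -/
def regret (greedy : QFun S A → Policy S A) (sel : List (List (Step S A)) → QFun S A)
    (T : ℕ) (D : List (List (Step S A))) : ℝ :=
  ∑ t ∈ Finset.range T, (M.Vstar 0 M.init - M.V (greedy (sel (D.take t))) 0 M.init)

end EpisodicMDP

end RL

end

/-! The `L^p` coefficient enters only at the end. The regret analysis uses the coverability `C_cov =
max_h ∑_x sup_π ρ_h^π(x)` (`coverability`) and gives regret at most `7 H √(C_cov β T log T)`; then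
`L = 7 √(C_cov / Ccw^{1/p})`. A single term of the series defining the norm already yields `ρ ≤
Ccw^{1/p} μ^{1-1/p}` pointwise (`le_of_ratioNorm_le`), and summing over state-action pairs bounds
`L` (`coverability_le_rpow_mul`). Comparison with uniformly random actions gives `C_cov ≤ |A|^H`, so
`L` is a real number chosen before the function class.

The regret bound rests on three facts.

Concentration: given the visited pair, the excess squared loss of `f_h` over its Bellman backup has
mean equal to the squared residual, and its noise is proportional to the residual. Hence the
accumulated expected squared residuals over 32 minus the accumulated excess over 8 (`deviation`) has
an exponential supermartingale. Markov's inequality, a union bound over times, steps and a net, and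
Lipschitz continuity in `f` bound it uniformly over the class. This bound is used twice: for `Q^⋆`
with one component replaced it puts `Q^⋆` in every confidence set (`Qstar_mem_confidenceSet`), and
for the selected `f^t` it bounds the squared residuals under all past policies
(`sum_expect_residual_sq_le`).

Decomposition: by optimism the regret of an episode is at most `f^t_1(s_1, π^t(s_1)) - V^{π^t}`,
which telescopes into expected Bellman residuals along `π^t` (`Admissible.sub_V_eq_sum`).

Change of measure: a logarithmic potential argument at each pair `x` turns small residuals under
past policies into small residuals under the current one; the cost summed over `x` is `C_cov`
(`PMF.sum_expect_le_potential`). -/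

namespace PMF

/-! ### Expectations and tail bounds for discrete distributions. -/

variable {α β : Type*}

theorem tsum_bind_mul (p : PMF α) (q : α → PMF β) (Z : β → ℝ≥0∞) :
    ∑' b, p.bind q b * Z b = ∑' a, p a * ∑' b, q a b * Z b := by
  simp only [bind_apply, ← ENNReal.tsum_mul_right, ← ENNReal.tsum_mul_left]
  rw [ENNReal.tsum_comm]
  simp only [mul_assoc]

theorem tsum_pure_mul (a : α) (Z : α → ℝ≥0∞) : ∑' b, PMF.pure a b * Z b = Z a := by
  rw [tsum_eq_single a]
  · simp
  · intro b hb
    simp [hb]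

theorem tsum_map_mul (p : PMF α) (g : α → β) (Z : β → ℝ≥0∞) :
    ∑' b, p.map g b * Z b = ∑' a, p a * Z (g a) := by
  rw [← bind_pure_comp, tsum_bind_mul]
  simp only [Function.comp_apply, tsum_pure_mul]

theorem tsum_mul_le_of_le (p : PMF α) (Z : α → ℝ≥0∞) (c : ℝ≥0∞) (h : ∀ a, Z a ≤ c) :
    ∑' a, p a * Z a ≤ c := by
  calc ∑' a, p a * Z a ≤ ∑' a, p a * c := ENNReal.tsum_le_tsum fun a => by gcongr; exact h a
    _ = c := by rw [ENNReal.tsum_mul_right, p.tsum_coe, one_mul]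

theorem summable_toReal (p : PMF α) : Summable fun a => (p a).toReal :=
  ENNReal.summable_toReal p.tsum_coe_ne_top

theorem tsum_toReal (p : PMF α) : ∑' a, (p a).toReal = 1 := by
  rw [← ENNReal.tsum_toReal_eq p.apply_ne_top, p.tsum_coe, ENNReal.toReal_one]

/-- The expectation of a real function under a discrete distribution. -/
noncomputable def expect (p : PMF α) (f : α → ℝ) : ℝ := ∑' a, (p a).toReal * f a

theorem expect_congr {p : PMF α} {f g : α → ℝ} (h : ∀ a ∈ p.support, f a = g a) :
    p.expect f = p.expect g := by
  refine tsum_congr fun a => ?_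
  by_cases ha : p a = 0
  · simp [ha]
  · rw [h a ha]

theorem summable_expect (p : PMF α) {f : α → ℝ} {C : ℝ} (h : ∀ a, |f a| ≤ C) :
    Summable fun a => (p a).toReal * f a := by
  refine Summable.of_norm_bounded (p.summable_toReal.mul_right C) fun a => ?_
  rw [norm_mul, Real.norm_of_nonneg ENNReal.toReal_nonneg]
  exact mul_le_mul_of_nonneg_left (h a) ENNReal.toReal_nonneg

theorem expect_const (p : PMF α) (c : ℝ) : p.expect (fun _ => c) = c := by
  rw [expect, tsum_mul_right, p.tsum_toReal, one_mul]

theorem expect_nonneg (p : PMF α) {f : α → ℝ} (h : ∀ a, 0 ≤ f a) : 0 ≤ p.expect f :=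
  tsum_nonneg fun a => mul_nonneg ENNReal.toReal_nonneg (h a)

theorem expect_const_mul (p : PMF α) (c : ℝ) (f : α → ℝ) :
    p.expect (fun a => c * f a) = c * p.expect f := by
  rw [expect, expect, ← tsum_mul_left]
  exact tsum_congr fun a => by ring

theorem expect_add (p : PMF α) {f g : α → ℝ} {C C' : ℝ} (hf : ∀ a, |f a| ≤ C)
    (hg : ∀ a, |g a| ≤ C') : p.expect (fun a => f a + g a) = p.expect f + p.expect g := by
  rw [expect, expect, expect, ← (p.summable_expect hf).tsum_add (p.summable_expect hg)]
  exact tsum_congr fun a => by ring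

theorem expect_sub (p : PMF α) {f g : α → ℝ} {C C' : ℝ} (hf : ∀ a, |f a| ≤ C)
    (hg : ∀ a, |g a| ≤ C') : p.expect (fun a => f a - g a) = p.expect f - p.expect g := by
  rw [expect, expect, expect, ← (p.summable_expect hf).tsum_sub (p.summable_expect hg)]
  exact tsum_congr fun a => by ring

theorem expect_mono (p : PMF α) {f g : α → ℝ} {C C' : ℝ} (hf : ∀ a, |f a| ≤ C)
    (hg : ∀ a, |g a| ≤ C') (h : ∀ a, f a ≤ g a) : p.expect f ≤ p.expect g :=
  (p.summable_expect hf).tsum_le_tsum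
    (fun a => mul_le_mul_of_nonneg_left (h a) ENNReal.toReal_nonneg) (p.summable_expect hg)

theorem expect_le (p : PMF α) {f : α → ℝ} {C c : ℝ} (hf : ∀ a, |f a| ≤ C) (h : ∀ a, f a ≤ c) :
    p.expect f ≤ c :=
  (p.expect_mono hf (fun _ => le_refl |c|) h).trans_eq (p.expect_const c)

theorem abs_expect_le (p : PMF α) {f : α → ℝ} {C : ℝ} (hf : ∀ a, |f a| ≤ C) :
    |p.expect f| ≤ C := by
  refine abs_le.2 ⟨?_, p.expect_le hf fun a => (abs_le.1 (hf a)).2⟩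
  exact (p.expect_const (-C)).symm.trans_le
    (p.expect_mono (fun _ => le_refl |(-C)|) hf fun a => (abs_le.1 (hf a)).1)

theorem ofReal_expect (p : PMF α) {f : α → ℝ} {C : ℝ} (h0 : ∀ a, 0 ≤ f a)
    (hf : ∀ a, |f a| ≤ C) : ENNReal.ofReal (p.expect f) = ∑' a, p a * ENNReal.ofReal (f a) := by
  rw [expect, ENNReal.ofReal_tsum_of_nonneg
    (fun a => mul_nonneg ENNReal.toReal_nonneg (h0 a)) (p.summable_expect hf)]
  refine tsum_congr fun a => ?_
  rw [ENNReal.ofReal_mul ENNReal.toReal_nonneg, ENNReal.ofReal_toReal (p.apply_ne_top a)]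

theorem expect_pure (a : α) (f : α → ℝ) : (PMF.pure a).expect f = f a := by
  rw [expect, tsum_eq_single a]
  · simp
  · intro b hb
    simp [hb]

/-- Tonelli in `ℝ≥0∞`, which needs no summability of the double series. -/
theorem expect_bind_of_nonneg (p : PMF α) (q : α → PMF β) {f : β → ℝ} {C : ℝ}
    (h0 : ∀ b, 0 ≤ f b) (hf : ∀ b, |f b| ≤ C) :
    (p.bind q).expect f = p.expect fun a => (q a).expect f := by
  have h1 : ∀ a, 0 ≤ (q a).expect f := fun a => (q a).expect_nonneg h0
  rw [← ENNReal.ofReal_eq_ofReal_iff ((p.bind q).expect_nonneg h0) (p.expect_nonneg h1),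
    ofReal_expect _ h0 hf, ofReal_expect _ h1 (fun a => (q a).abs_expect_le hf), tsum_bind_mul]
  exact tsum_congr fun a => by rw [ofReal_expect _ h0 hf]

theorem expect_bind_of_bounded (p : PMF α) (q : α → PMF β) {f : β → ℝ} {C : ℝ}
    (hf : ∀ b, |f b| ≤ C) :
    (p.bind q).expect f = p.expect fun a => (q a).expect f := by
  have hC : ∀ b, |f b + C| ≤ C + |C| := fun b => (abs_add_le _ _).trans (by gcongr; exact hf b)
  have key := p.expect_bind_of_nonneg q (f := fun b => f b + C) (C := C + |C|)
    (fun b => by linarith [(abs_le.1 (hf b)).1]) hC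
  have hc : ∀ _ : β, |C| ≤ |C| := fun _ => le_rfl
  have hc' : ∀ _ : α, |C| ≤ |C| := fun _ => le_rfl
  rw [expect_add _ hf hc, expect_const] at key
  have h2 : ∀ a, (q a).expect (fun b => f b + C) = (q a).expect f + C := fun a => by
    rw [expect_add _ hf hc, expect_const]
  simp only [h2] at key
  rw [expect_add _ (fun a => (q a).abs_expect_le hf) hc', expect_const] at key
  linarith

/-- Total rewards are bounded only on the support of a rollout. Setting `f` to zero off the support
changes neither side and makes it bounded everywhere. -/
theorem expect_bind (p : PMF α) (q : α → PMF β) {f : β → ℝ} {C : ℝ}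
    (hf : ∀ b ∈ (p.bind q).support, |f b| ≤ C) :
    (p.bind q).expect f = p.expect fun a => (q a).expect f := by
  classical
  set g : β → ℝ := fun b => if b ∈ (p.bind q).support then f b else 0 with hg
  have hgC : ∀ b, |g b| ≤ |C| := fun b => by
    simp only [hg]
    split_ifs with hb
    · exact (hf b hb).trans (le_abs_self C)
    · simp
  rw [expect_congr (g := g) (fun b hb => by simp only [hg, if_pos hb]),
    expect_bind_of_bounded p q hgC]
  refine expect_congr fun a ha => expect_congr fun b hb => ?_
  simp only [hg]
  rw [if_pos]
  exact (mem_support_bind_iff p q b).2 ⟨a, ha, hb⟩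

theorem expect_map (p : PMF α) (g : α → β) (f : β → ℝ) {C : ℝ}
    (hf : ∀ b ∈ (p.map g).support, |f b| ≤ C) :
    (p.map g).expect f = p.expect fun a => f (g a) := by
  rw [← bind_pure_comp] at hf ⊢
  rw [expect_bind p _ hf]
  simp only [Function.comp_apply, expect_pure]

/-- Markov's inequality for `exp Z`. -/
theorem toOuterMeasure_le_of_tsum_mul_le_one (p : PMF α) (Z : α → ℝ) (ℓ : ℝ)
    (hZ : ∑' a, p a * ENNReal.ofReal (Real.exp (Z a)) ≤ 1) :
    p.toOuterMeasure {a | ℓ < Z a} ≤ ENNReal.ofReal (Real.exp (-ℓ)) := by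
  classical
  rw [toOuterMeasure_apply]
  calc ∑' a, Set.indicator {a | ℓ < Z a} p a
      ≤ ∑' a, p a * ENNReal.ofReal (Real.exp (Z a)) * ENNReal.ofReal (Real.exp (-ℓ)) := by
        refine ENNReal.tsum_le_tsum fun a => ?_
        by_cases ha : ℓ < Z a
        · rw [Set.indicator_of_mem (by exact ha), mul_assoc,
            ← ENNReal.ofReal_mul (Real.exp_nonneg _), ← Real.exp_add]
          refine le_mul_of_one_le_right' ?_
          rw [← ENNReal.ofReal_one]
          exact ENNReal.ofReal_le_ofReal (Real.one_le_exp (by linarith))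
        · rw [Set.indicator_of_notMem (by exact ha)]
          exact zero_le
    _ ≤ 1 * ENNReal.ofReal (Real.exp (-ℓ)) := by
        rw [ENNReal.tsum_mul_right]
        gcongr
    _ = _ := one_mul _

/-- Points off the support carry no mass, so only histories that can occur have to be good; the
selection rule is constrained only there. -/
theorem ofReal_one_sub_le_toOuterMeasure (p : PMF α) {G B : Set α} {δ : ℝ} (hδ : 0 ≤ δ)
    (hB : p.toOuterMeasure B ≤ ENNReal.ofReal δ) (h : ∀ a ∈ p.support, a ∉ B → a ∈ G) :
    ENNReal.ofReal (1 - δ) ≤ p.toOuterMeasure G := by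
  rw [ENNReal.ofReal_sub _ hδ, ENNReal.ofReal_one, tsub_le_iff_right]
  have h1 : p.toOuterMeasure Set.univ = 1 := by
    rw [toOuterMeasure_apply]
    simp
  calc (1 : ℝ≥0∞) = p.toOuterMeasure (Set.univ ∩ p.support) := by
        rw [toOuterMeasure_apply_inter_support, h1]
    _ ≤ p.toOuterMeasure (G ∪ B) := by
        refine MeasureTheory.measure_mono fun a ha => ?_
        by_cases hb : a ∈ B
        · exact Or.inr hb
        · exact Or.inl (h a ha.2 hb)
    _ ≤ p.toOuterMeasure G + p.toOuterMeasure B := MeasureTheory.measure_union_le _ _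
    _ ≤ _ := by gcongr

end PMF

/-! ### Laws of visited pairs and of single steps. -/

namespace RL.EpisodicMDP

variable {S : Type u} {A : Type v} (M : EpisodicMDP S A)

/-- The law of the state-action pair reached after `k` transitions when action `a` is taken in
state `s` at step `h`, and the policy `π` is followed afterwards. -/
noncomputable def stepLaw (π : Policy S A) : ℕ → ℕ → S → A → PMF (S × A)
  | 0, _, s, a => PMF.pure (s, a)
  | k + 1, h, s, a => (M.P h s a).bind fun s' => stepLaw π k (h + 1) s' (π (h + 1) s')

/-- The law of the state-action pair visited at step `h` of an episode. -/
noncomputable def visitLaw (π : Policy S A) (h : ℕ) : PMF (S × A) :=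
  M.stepLaw π h 0 M.init (π 0 M.init)

/-- Disintegrates a recorded step into the visited pair and a fresh transition from it, so that
losses can be averaged conditionally on the pair. -/
theorem rollout_map_getElem? (π : Policy S A) : ∀ (n k h : ℕ) (s : S) (a : A), k < n →
    (M.rollout π n h s a).map (fun l => l[k]?) =
      (M.stepLaw π k h s a).bind fun x => (M.P (h + k) x.1 x.2).map fun s' =>
        some ⟨x.1, x.2, M.r (h + k) x.1 x.2, s'⟩
  | n + 1, 0, h, s, a, _ => by
    simp only [rollout, stepLaw, PMF.map_bind, PMF.map_comp, PMF.pure_bind, Function.comp_def,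
      List.getElem?_cons_zero, add_zero]
    rw [← PMF.bind_pure_comp]
    congr 1
    funext s'
    exact PMF.map_const _ _
  | n + 1, k + 1, h, s, a, hk => by
    simp only [rollout, stepLaw, PMF.map_bind, PMF.map_comp, PMF.bind_bind, Function.comp_def,
      List.getElem?_cons_succ]
    congr 1
    funext s'
    rw [rollout_map_getElem? π n k (h + 1) s' _ (by omega), show h + 1 + k = h + (k + 1) by ring]

theorem episode_map_getElem? (π : Policy S A) {h : ℕ} (hh : h < M.H) :
    (M.episode π).map (fun l => l[h]?) =
      (M.visitLaw π h).bind fun x => (M.P h x.1 x.2).map fun s' =>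
        some ⟨x.1, x.2, M.r h x.1 x.2, s'⟩ := by
  have := M.rollout_map_getElem? π M.H h 0 M.init (π 0 M.init) hh
  rwa [zero_add] at this

theorem occupancy_eq_visitLaw (π : Policy S A) {h : ℕ} (hh : h < M.H) (x : S × A) :
    M.occupancy π h x = M.visitLaw π h x := by
  have h1 : {l : List (Step S A) | ∃ e, l[h]? = some e ∧ e.state = x.1 ∧ e.action = x.2} =
      (fun l : List (Step S A) => l[h]?) ⁻¹'
        ((Option.map fun e : Step S A => (e.state, e.action)) ⁻¹' {some x}) := by
    ext l
    simp [Prod.ext_iff]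
  rw [occupancy, h1, ← PMF.toOuterMeasure_map_apply, M.episode_map_getElem? π hh,
    ← PMF.toOuterMeasure_map_apply, PMF.map_bind]
  simp only [PMF.map_comp, Function.comp_def, Option.map_some]
  have h2 : ((M.visitLaw π h).bind fun x => (M.P h x.1 x.2).map fun _ => some x) =
      (M.visitLaw π h).map some := by
    rw [← PMF.bind_pure_comp]
    congr 1
    funext x
    exact PMF.map_const _ _
  simp only [Prod.mk.eta]
  rw [h2, PMF.toOuterMeasure_map_apply,
    show some ⁻¹' {some x} = {x} by ext; simp, PMF.toOuterMeasure_apply_singleton]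

theorem reward_eq_of_mem_support_rollout (π : Policy S A) : ∀ (n h : ℕ) (s : S) (a : A)
    (l : List (Step S A)), l ∈ (M.rollout π n h s a).support →
    ∀ (k : ℕ) (e : Step S A), l[k]? = some e → e.reward = M.r (h + k) e.state e.action
  | 0, h, s, a, l, hl, k, e, he => by
    simp only [rollout, PMF.support_pure, Set.mem_singleton_iff] at hl
    simp [hl] at he
  | n + 1, h, s, a, l, hl, k, e, he => by
    simp only [rollout, PMF.mem_support_bind_iff, PMF.mem_support_map_iff] at hl
    obtain ⟨s', -, l', hl', rfl⟩ := hl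
    cases k with
    | zero =>
      simp only [List.getElem?_cons_zero, Option.some.injEq] at he
      subst he
      rfl
    | succ k =>
      rw [List.getElem?_cons_succ] at he
      rw [reward_eq_of_mem_support_rollout π n (h + 1) s' _ l' hl' k e he,
        show h + 1 + k = h + (k + 1) by ring]

end RL.EpisodicMDP

/-! ### The potential argument. -/

theorem sum_ite_partialSum_lt_le {a : ℕ → ℝ} {m : ℝ} {T : ℕ} (h0 : ∀ t < T, 0 ≤ a t)
    (hm : ∀ t < T, a t ≤ m) (hm0 : 0 ≤ m) :
    ∑ t ∈ Finset.range T, (if ∑ i ∈ Finset.range t, a i < m then a t else 0) ≤ 2 * m := by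
  -- Keeping the full partial sum in the minimum closes the induction: a counted term is added to a
  -- sum below `m` and is itself at most `m`.
  suffices h : ∀ n ≤ T, ∑ t ∈ Finset.range n, (if ∑ i ∈ Finset.range t, a i < m then a t else 0) ≤
      min (∑ i ∈ Finset.range n, a i) (2 * m) from (h T le_rfl).trans (min_le_right _ _)
  intro n
  induction n with
  | zero => intro _; simp [hm0]
  | succ n ih =>
    intro hn
    have h1 := le_min_iff.1 (ih (by omega))
    have h2 := h0 n (by omega)
    have h3 := hm n (by omega)
    rw [Finset.sum_range_succ, Finset.sum_range_succ, le_min_iff]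
    split_ifs with hlt
    · constructor <;> linarith
    · constructor <;> linarith

/-- Past the threshold, `a ≤ m ≤ w` gives `a²/w ≤ m a/w ≤ 2m log((w + a)/w)`. The logarithms
telescope from `m` to at most `T m`; the maximum with `m` in the potential absorbs the terms before
the threshold. -/
theorem sum_ite_sq_div_partialSum_le {a : ℕ → ℝ} {m : ℝ} {T : ℕ} (hT : 1 ≤ T)
    (h0 : ∀ t < T, 0 ≤ a t) (hm : ∀ t < T, a t ≤ m) (hm0 : 0 < m) :
    ∑ t ∈ Finset.range T, (if ∑ i ∈ Finset.range t, a i < m then 0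
      else a t ^ 2 / ∑ i ∈ Finset.range t, a i) ≤ 2 * m * Real.log T := by
  have h : ∀ n ≤ T, ∑ t ∈ Finset.range n, (if ∑ i ∈ Finset.range t, a i < m then 0
      else a t ^ 2 / ∑ i ∈ Finset.range t, a i) ≤
      2 * m * Real.log (max (∑ i ∈ Finset.range n, a i) m / m) := by
    intro n
    induction n with
    | zero => intro _; simp [hm0.le, hm0.ne']
    | succ n ih =>
      intro hn
      have h1 := ih (by omega)
      have h2 := h0 n (by omega)
      have h3 := hm n (by omega)
      rw [Finset.sum_range_succ, Finset.sum_range_succ]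
      set w := ∑ i ∈ Finset.range n, a i with hw
      split_ifs with hlt
      · rw [add_zero]
        refine h1.trans ?_
        gcongr
        linarith
      · push Not at hlt
        have hw0 : 0 < w := hm0.trans_le hlt
        rw [max_eq_left hlt] at h1
        rw [max_eq_left (by linarith)]
        have h4 : Real.log ((w + a n) / m) = Real.log (w / m) + Real.log ((w + a n) / w) := by
          rw [← Real.log_mul (by positivity) (by positivity)]
          congr 1
          field_simp
        have h5 := Real.one_sub_inv_le_log_of_pos (x := (w + a n) / w) (by positivity)
        have h6 : a n / (2 * w) ≤ 1 - ((w + a n) / w)⁻¹ := by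
          rw [inv_div, one_sub_div (by positivity), add_sub_cancel_left]
          gcongr
          linarith
        have h7 : a n ^ 2 / w ≤ 2 * m * (a n / (2 * w)) := by
          have : 2 * m * (a n / (2 * w)) = m * a n / w := by field_simp
          rw [this]
          gcongr
          nlinarith
        have h8 : 2 * m * (a n / (2 * w)) ≤ 2 * m * Real.log ((w + a n) / w) := by
          gcongr
          exact h6.trans h5
        rw [h4, mul_add]
        linarith
  refine (h T le_rfl).trans ?_
  have hsum : ∑ i ∈ Finset.range T, a i ≤ T * m := by
    refine (Finset.sum_le_card_nsmul _ _ m fun i hi => hm i (Finset.mem_range.1 hi)).trans_eq ?_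
    simp
  have hT' : (1 : ℝ) ≤ T := by exact_mod_cast hT
  have h9 : max (∑ i ∈ Finset.range T, a i) m / m ≤ T := by
    rw [div_le_iff₀ hm0]
    exact max_le hsum (by nlinarith)
  gcongr

/-- Before the past mass reaches `m`, bound `y` by 1 and pay `2m` in total. Afterwards split `a y`
by AM-GM with weight `η` into `a²/w`, controlled by the logarithmic potential, and `w y²`, the error
under past weights. -/
theorem sum_mul_le_potential {a y : ℕ → ℝ} {m η : ℝ} {T : ℕ} (hT : 1 ≤ T)
    (h0 : ∀ t < T, 0 ≤ a t) (hm : ∀ t < T, a t ≤ m) (hy : ∀ t < T, |y t| ≤ 1) (hη : 0 < η) :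
    ∑ t ∈ Finset.range T, a t * y t ≤ 2 * m + η * (m * Real.log T) +
      1 / (2 * η) * ∑ t ∈ Finset.range T, ∑ i ∈ Finset.range t, a i * y t ^ 2 := by
  have hm0 : 0 ≤ m := (h0 0 hT).trans (hm 0 hT)
  have hS : ∀ t < T, 0 ≤ ∑ i ∈ Finset.range t, a i := fun t ht =>
    Finset.sum_nonneg fun i hi => h0 i ((Finset.mem_range.1 hi).trans ht)
  rcases hm0.eq_or_lt with rfl | hm0
  · have : ∑ t ∈ Finset.range T, a t * y t = 0 := Finset.sum_eq_zero fun t ht => by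
      rw [le_antisymm (hm t (Finset.mem_range.1 ht)) (h0 t (Finset.mem_range.1 ht)), zero_mul]
    rw [this]
    have : 0 ≤ ∑ t ∈ Finset.range T, ∑ i ∈ Finset.range t, a i * y t ^ 2 :=
      Finset.sum_nonneg fun t ht => by
        rw [← Finset.sum_mul]
        exact mul_nonneg (hS t (Finset.mem_range.1 ht)) (sq_nonneg _)
    have : 0 ≤ 1 / (2 * η) := by positivity
    simp only [mul_zero, zero_mul, zero_add]
    positivity
  · have hA := sum_ite_partialSum_lt_le h0 hm hm0.le
    have hB := sum_ite_sq_div_partialSum_le hT h0 hm hm0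
    have key : ∑ t ∈ Finset.range T, a t * y t ≤ ∑ t ∈ Finset.range T,
        ((if ∑ i ∈ Finset.range t, a i < m then a t else 0) +
          η / 2 * (if ∑ i ∈ Finset.range t, a i < m then 0
            else a t ^ 2 / ∑ i ∈ Finset.range t, a i) +
          1 / (2 * η) * ∑ i ∈ Finset.range t, a i * y t ^ 2) := by
      refine Finset.sum_le_sum fun t ht => ?_
      have ht := Finset.mem_range.1 ht
      have h1 := h0 t ht
      have h2 := hS t ht
      have h3 := (abs_le.1 (hy t ht))
      rw [← Finset.sum_mul]
      set w := ∑ i ∈ Finset.range t, a i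
      split_ifs with hlt
      · have : 0 ≤ 1 / (2 * η) * (w * y t ^ 2) := by positivity
        nlinarith
      · have hw : 0 < w := hm0.trans_le (not_lt.1 hlt)
        -- AM-GM as a completed square.
        have : η / 2 * (a t ^ 2 / w) + 1 / (2 * η) * (w * y t ^ 2) - a t * y t =
            (η * a t - w * y t) ^ 2 / (2 * η * w) := by
          field_simp
          ring
        have h4 : 0 ≤ (η * a t - w * y t) ^ 2 / (2 * η * w) := by positivity
        linarith
    rw [Finset.sum_add_distrib, Finset.sum_add_distrib, ← Finset.mul_sum, ← Finset.mul_sum] at key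
    have : η / 2 * (∑ t ∈ Finset.range T, (if ∑ i ∈ Finset.range t, a i < m then 0
            else a t ^ 2 / ∑ i ∈ Finset.range t, a i)) ≤ η / 2 * (2 * m * Real.log T) := by
      gcongr
    linarith

/-- One envelope `m` dominates all the laws, so the scalar inequality can be summed over `x`. With
`m` the supremum of the occupancies, its total mass is at most the coverability. -/
theorem PMF.sum_expect_le_potential {X : Type*} {d : ℕ → PMF X} {m : X → ℝ} {C R η : ℝ} {T : ℕ}
    {φ : ℕ → X → ℝ} (hT : 1 ≤ T) (hm : ∀ t < T, ∀ x, (d t x).toReal ≤ m x)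
    (hms : Summable m) (hC : ∑' x, m x ≤ C) (hφ : ∀ t < T, ∀ x, |φ t x| ≤ 1) (hη : 0 < η)
    (hR : ∀ t < T, ∑ i ∈ Finset.range t, (d i).expect (fun x => φ t x ^ 2) ≤ R) :
    ∑ t ∈ Finset.range T, (d t).expect (φ t) ≤
      2 * C + η * (C * Real.log T) + T * R / (2 * η) := by
  have hφ2 : ∀ t < T, ∀ x, |φ t x ^ 2| ≤ 1 := fun t ht x => by
    rw [abs_pow]
    exact pow_le_one₀ (abs_nonneg _) (hφ t ht x)
  have s1 : ∀ t ∈ Finset.range T, Summable fun x => (d t x).toReal * φ t x := fun t ht =>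
    (d t).summable_expect (hφ t (Finset.mem_range.1 ht))
  have s2 : ∀ t ∈ Finset.range T, ∀ i ∈ Finset.range t,
      Summable fun x => (d i x).toReal * φ t x ^ 2 := fun t ht i _ =>
    (d i).summable_expect (hφ2 t (Finset.mem_range.1 ht))
  have s3 : Summable fun x => ∑ t ∈ Finset.range T, ∑ i ∈ Finset.range t,
      (d i x).toReal * φ t x ^ 2 := summable_sum fun t ht => summable_sum (s2 t ht)
  have e1 : ∑ t ∈ Finset.range T, (d t).expect (φ t) =
      ∑' x, ∑ t ∈ Finset.range T, (d t x).toReal * φ t x := (Summable.tsum_finsetSum s1).symm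
  have e2 : ∑' x, ∑ t ∈ Finset.range T, ∑ i ∈ Finset.range t, (d i x).toReal * φ t x ^ 2 =
      ∑ t ∈ Finset.range T, ∑ i ∈ Finset.range t, (d i).expect (fun x => φ t x ^ 2) := by
    rw [Summable.tsum_finsetSum fun t ht => summable_sum (s2 t ht)]
    exact Finset.sum_congr rfl fun t ht => Summable.tsum_finsetSum (s2 t ht)
  have s4 : Summable fun x => 2 * m x + η * (m x * Real.log T) := by
    exact (hms.mul_left 2).add ((hms.mul_right (Real.log T)).mul_left η)
  rw [e1]
  have hle := Summable.tsum_le_tsum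
    (fun x => sum_mul_le_potential hT (fun t _ => ENNReal.toReal_nonneg)
      (fun t ht => hm t ht x) (fun t ht => hφ t ht x) hη)
    (summable_sum s1) (s4.add (s3.mul_left (1 / (2 * η))))
  refine hle.trans ?_
  rw [s4.tsum_add (s3.mul_left _), (hms.mul_left 2).tsum_add
    ((hms.mul_right (Real.log T)).mul_left η), tsum_mul_left, tsum_mul_left, tsum_mul_left,
    tsum_mul_right, e2]
  have hlog : 0 ≤ Real.log T := Real.log_natCast_nonneg T
  have hsum : ∑ t ∈ Finset.range T, ∑ i ∈ Finset.range t, (d i).expect (fun x => φ t x ^ 2) ≤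
      T * R := by
    refine (Finset.sum_le_card_nsmul _ _ R fun t ht => hR t (Finset.mem_range.1 ht)).trans_eq ?_
    simp
  have h5 : T * R / (2 * η) = 1 / (2 * η) * (T * R) := by ring
  rw [h5]
  gcongr

/-! ### Dynamic programming and the decomposition of regret. -/

namespace PMF

theorem expect_sum {α ι : Type*} (p : PMF α) (s : Finset ι) {f : ι → α → ℝ} {C : ℝ}
    (hf : ∀ i ∈ s, ∀ a, |f i a| ≤ C) :
    p.expect (fun a => ∑ i ∈ s, f i a) = ∑ i ∈ s, p.expect (f i) := by
  simp only [expect, Finset.mul_sum]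
  exact Summable.tsum_finsetSum fun i hi => p.summable_expect (hf i hi)

theorem expect_const_add_of_mem_support {α : Type*} (p : PMF α) (c : ℝ) {f : α → ℝ} {C : ℝ}
    (hf : ∀ a ∈ p.support, |f a| ≤ C) : p.expect (fun a => c + f a) = c + p.expect f := by
  classical
  set g : α → ℝ := fun a => if a ∈ p.support then f a else 0 with hg
  have hfg : ∀ a ∈ p.support, f a = g a := fun a ha => by simp only [hg, if_pos ha]
  have hgC : ∀ a, |g a| ≤ |C| := fun a => by
    simp only [hg]
    split_ifs with ha
    · exact (hf a ha).trans (le_abs_self C)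
    · simp
  rw [expect_congr hfg, expect_congr (g := fun a => c + g a) fun a ha => by rw [hfg a ha],
    expect_add p (fun _ => le_refl |c|) hgC, expect_const]

end PMF

theorem abs_le_one_of_mem_Icc {x : ℝ} (h : x ∈ Set.Icc (0 : ℝ) 1) : |x| ≤ 1 :=
  abs_le.2 ⟨by linarith [h.1], h.2⟩

theorem ciSup_mem_Icc {A : Type v} [Finite A] [Nonempty A] {g : A → ℝ} {l u : ℝ}
    (hg : ∀ a, g a ∈ Set.Icc l u) : ⨆ a, g a ∈ Set.Icc l u :=
  ⟨(hg (Classical.arbitrary A)).1.trans (le_ciSup (Set.finite_range g).bddAbove _),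
    ciSup_le fun a => (hg a).2⟩

theorem ciSup_eq_of_forall_le {A : Type v} [Finite A] [Nonempty A] {g : A → ℝ} {a : A}
    (h : ∀ b, g b ≤ g a) : ⨆ b, g b = g a :=
  le_antisymm (ciSup_le h) (le_ciSup (Set.finite_range g).bddAbove a)

namespace RL.EpisodicMDP

variable {S : Type u} {A : Type v} (M : EpisodicMDP S A)

theorem totalReward_mem_Icc (hr : ∀ h < M.H, ∀ s a, M.r h s a ∈ Set.Icc (0 : ℝ) 1)
    (π : Policy S A) : ∀ (n h : ℕ) (s : S) (a : A), h + n ≤ M.H →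
    ∀ l ∈ (M.rollout π n h s a).support, totalReward l ∈ Set.Icc (0 : ℝ) n
  | 0, h, s, a, _, l, hl => by
    simp only [rollout, PMF.support_pure, Set.mem_singleton_iff] at hl
    simp [hl, totalReward]
  | n + 1, h, s, a, hn, l, hl => by
    simp only [rollout, PMF.mem_support_bind_iff, PMF.mem_support_map_iff] at hl
    obtain ⟨s', -, l', hl', rfl⟩ := hl
    have h1 := totalReward_mem_Icc hr π n (h + 1) s' _ (by omega) l' hl'
    have h2 := hr h (by omega) s a
    simp only [totalReward, List.map_cons, List.sum_cons, Set.mem_Icc] at h1 h2 ⊢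
    push_cast
    constructor <;> linarith

theorem abs_totalReward_le (hr : ∀ h < M.H, ∀ s a, M.r h s a ∈ Set.Icc (0 : ℝ) 1)
    (π : Policy S A) {n h : ℕ} (s : S) (a : A) (hn : h + n ≤ M.H) {l : List (Step S A)}
    (hl : l ∈ (M.rollout π n h s a).support) : |totalReward l| ≤ n := by
  have := M.totalReward_mem_Icc hr π n h s a hn l hl
  rw [abs_of_nonneg this.1]
  exact this.2

theorem Q_eq_expect (π : Policy S A) (h : ℕ) (s : S) (a : A) :
    M.Q π h s a = (M.rollout π (M.H - h) h s a).expect totalReward := rfl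

theorem bellman_eq_expect (h : ℕ) (f : S → A → ℝ) (s : S) (a : A) :
    M.bellman h f s a = M.r h s a + (M.P h s a).expect fun s' => ⨆ a', f s' a' := rfl

theorem Q_of_horizon_le (π : Policy S A) {h : ℕ} (hh : M.H ≤ h) (s : S) (a : A) :
    M.Q π h s a = 0 := by
  rw [Q_eq_expect, Nat.sub_eq_zero_of_le hh, rollout, PMF.expect_pure]
  simp [totalReward]

theorem Q_succ (hr : ∀ h < M.H, ∀ s a, M.r h s a ∈ Set.Icc (0 : ℝ) 1)
    (π : Policy S A) {h : ℕ} (hh : h < M.H) (s : S) (a : A) :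
    M.Q π h s a = M.r h s a + (M.P h s a).expect fun s' => M.V π (h + 1) s' := by
  obtain ⟨n, hn⟩ : ∃ n, M.H = h + n + 1 := ⟨M.H - h - 1, by omega⟩
  have e1 : M.H - h = n + 1 := by omega
  have e2 : M.H - (h + 1) = n := by omega
  have hbd : ∀ l ∈ (M.rollout π (n + 1) h s a).support, |totalReward l| ≤ (n + 1 : ℕ) :=
    fun l hl => M.abs_totalReward_le hr π s a (by omega) hl
  rw [rollout] at hbd
  have hV : ∀ s', (M.V π (h + 1) s') ∈ Set.Icc (0 : ℝ) n := fun s' => by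
    have h0 := fun l hl => M.totalReward_mem_Icc hr π n (h + 1) s' (π (h + 1) s') (by omega) l hl
    classical
    rw [V, Q_eq_expect, e2, PMF.expect_congr
      (g := fun l => if l ∈ (M.rollout π n (h + 1) s' (π (h + 1) s')).support
        then totalReward l else 0) fun l hl => by rw [if_pos hl]]
    have h1 : ∀ l, (if l ∈ (M.rollout π n (h + 1) s' (π (h + 1) s')).support
        then totalReward l else 0) ∈ Set.Icc (0 : ℝ) n := fun l => by
      split_ifs with hl
      · exact h0 l hl
      · simp
    exact ⟨PMF.expect_nonneg _ fun l => (h1 l).1,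
      PMF.expect_le _ (fun l => (abs_of_nonneg (h1 l).1).trans_le (h1 l).2) fun l => (h1 l).2⟩
  rw [Q_eq_expect, e1, rollout, PMF.expect_bind _ _ hbd, ← PMF.expect_const_add_of_mem_support
    _ _ fun s' _ => (abs_of_nonneg (hV s').1).trans_le (hV s').2]
  refine PMF.expect_congr fun s' hs' => ?_
  rw [PMF.expect_map _ _ _ fun l hl => hbd l ((PMF.mem_support_bind_iff _ _ _).2 ⟨s', hs', hl⟩),
    V, Q_eq_expect, e2, ← PMF.expect_const_add_of_mem_support _ _ fun l hl =>
      M.abs_totalReward_le hr π s' _ (by omega) hl]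
  simp [totalReward]

theorem Q_mem_Icc (hr : ∀ h < M.H, ∀ s a, M.r h s a ∈ Set.Icc (0 : ℝ) 1)
    (π : Policy S A) : ∀ (n h : ℕ) (s : S) (a : A), h + n = M.H →
    M.Q π h s a ∈ Set.Icc (0 : ℝ) n
  | 0, h, s, a, hn => by
    rw [Q_of_horizon_le M π (by omega)]
    simp
  | n + 1, h, s, a, hn => by
    have h1 : ∀ s', M.V π (h + 1) s' ∈ Set.Icc (0 : ℝ) n := fun s' =>
      Q_mem_Icc hr π n (h + 1) s' _ (by omega)
    have h2 := hr h (by omega) s a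
    rw [M.Q_succ hr π (by omega)]
    have h3 := (M.P h s a).expect_nonneg fun s' => (h1 s').1
    have h4 := (M.P h s a).expect_le (fun s' => (abs_of_nonneg (h1 s').1).trans_le (h1 s').2)
      fun s' => (h1 s').2
    push_cast
    constructor <;> linarith [h2.1, h2.2]

theorem V_nonneg (hr : ∀ h < M.H, ∀ s a, M.r h s a ∈ Set.Icc (0 : ℝ) 1)
    (π : Policy S A) (s : S) : 0 ≤ M.V π 0 s :=
  (M.Q_mem_Icc hr π M.H 0 s _ (by simp)).1

/-- The value iteration with `n` steps to go. -/
noncomputable def valueIteration : ℕ → S → A → ℝ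
  | 0 => 0
  | n + 1 => M.bellman (M.H - (n + 1)) (valueIteration n)

theorem Qstar_of_horizon_le {h : ℕ} (hh : M.H ≤ h) : M.Qstar h = 0 := by
  funext s a
  simp [Qstar, M.Q_of_horizon_le _ hh]

section Optimality

variable [Fintype A] [Nonempty A]

theorem valueIteration_mem_Icc (hr : ∀ h < M.H, ∀ s a, M.r h s a ∈ Set.Icc (0 : ℝ) 1) :
    ∀ n ≤ M.H, ∀ s a, M.valueIteration n s a ∈ Set.Icc (0 : ℝ) n
  | 0, _, s, a => by simp [valueIteration]
  | n + 1, hn, s, a => by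
    have h1 : ∀ s', ⨆ a', M.valueIteration n s' a' ∈ Set.Icc (0 : ℝ) n := fun s' =>
      ciSup_mem_Icc fun a' => valueIteration_mem_Icc hr n (by omega) s' a'
    have h2 := hr (M.H - (n + 1)) (by omega) s a
    rw [valueIteration, bellman_eq_expect]
    have h3 := (M.P (M.H - (n + 1)) s a).expect_nonneg fun s' => (h1 s').1
    have h4 := (M.P (M.H - (n + 1)) s a).expect_le
      (fun s' => (abs_of_nonneg (h1 s').1).trans_le (h1 s').2) fun s' => (h1 s').2
    push_cast
    constructor <;> linarith [h2.1, h2.2]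

theorem Q_le_valueIteration (hr : ∀ h < M.H, ∀ s a, M.r h s a ∈ Set.Icc (0 : ℝ) 1)
    (π : Policy S A) : ∀ n ≤ M.H, ∀ s a, M.Q π (M.H - n) s a ≤ M.valueIteration n s a
  | 0, _, s, a => by simp [valueIteration, Q_of_horizon_le]
  | n + 1, hn, s, a => by
    have e : M.H - (n + 1) + 1 = M.H - n := by omega
    rw [M.Q_succ hr π (by omega), valueIteration, bellman_eq_expect, e]
    have h1 : ∀ s', ⨆ a', M.valueIteration n s' a' ∈ Set.Icc (0 : ℝ) n := fun s' =>
      ciSup_mem_Icc fun a' => M.valueIteration_mem_Icc hr n (by omega) s' a'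
    have h2 : ∀ s', M.V π (M.H - n) s' ∈ Set.Icc (0 : ℝ) n := fun s' =>
      M.Q_mem_Icc hr π n (M.H - n) s' _ (by omega)
    gcongr
    refine PMF.expect_mono _ (fun s' => (abs_of_nonneg (h2 s').1).trans_le (h2 s').2)
      (fun s' => (abs_of_nonneg (h1 s').1).trans_le (h1 s').2) fun s' => ?_
    exact (Q_le_valueIteration hr π n (by omega) s' _).trans
      (le_ciSup (Set.finite_range (M.valueIteration n s')).bddAbove _)

/-- One policy, greedy for value iteration, attains it at all steps and pairs simultaneously; hence
the supremum in `Qstar` obeys the Bellman equation. -/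
theorem exists_Q_eq_valueIteration (hr : ∀ h < M.H, ∀ s a, M.r h s a ∈ Set.Icc (0 : ℝ) 1) :
    ∃ π : Policy S A, ∀ n ≤ M.H, ∀ s a, M.Q π (M.H - n) s a = M.valueIteration n s a := by
  have hmax : ∀ (h : ℕ) (s : S), ∃ a, ∀ b, M.valueIteration (M.H - h) s b ≤
      M.valueIteration (M.H - h) s a := fun h s => Finite.exists_max _
  choose π hπ using hmax
  refine ⟨π, fun n => ?_⟩
  induction n with
  | zero => intro _ s a; simp [valueIteration, Q_of_horizon_le]
  | succ n ih =>
    intro hn s a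
    have e : M.H - (n + 1) + 1 = M.H - n := by omega
    rw [M.Q_succ hr π (by omega), valueIteration, bellman_eq_expect, e]
    congr 1
    refine PMF.expect_congr fun s' _ => ?_
    rw [V, ih (by omega)]
    have := hπ (M.H - n) s'
    rw [show M.H - (M.H - n) = n by omega] at this
    exact (ciSup_eq_of_forall_le this).symm

theorem Qstar_eq_valueIteration (hr : ∀ h < M.H, ∀ s a, M.r h s a ∈ Set.Icc (0 : ℝ) 1)
    {n : ℕ} (hn : n ≤ M.H) : M.Qstar (M.H - n) = M.valueIteration n := by
  obtain ⟨π, hπ⟩ := M.exists_Q_eq_valueIteration hr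
  funext s a
  have hle := fun π' => M.Q_le_valueIteration hr π' n hn s a
  have : Nonempty (Policy S A) := ⟨π⟩
  refine le_antisymm (ciSup_le hle) ?_
  rw [← hπ n hn s a]
  exact le_ciSup (f := fun π' => M.Q π' (M.H - n) s a)
    ⟨_, by rintro _ ⟨π', rfl⟩; exact hle π'⟩ π

theorem bellman_Qstar (hr : ∀ h < M.H, ∀ s a, M.r h s a ∈ Set.Icc (0 : ℝ) 1)
    {h : ℕ} (hh : h < M.H) : M.bellman h (M.Qstar (h + 1)) = M.Qstar h := by
  obtain ⟨n, hn⟩ : ∃ n, M.H = h + n + 1 := ⟨M.H - h - 1, by omega⟩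
  have e1 : M.Qstar (h + 1) = M.valueIteration n := by
    rw [← M.Qstar_eq_valueIteration hr (by omega)]
    congr 1
    omega
  have e2 : M.Qstar h = M.valueIteration (n + 1) := by
    rw [← M.Qstar_eq_valueIteration hr (by omega)]
    congr 1
    omega
  rw [e1, e2, valueIteration]
  congr 1
  omega

theorem Vstar_le_of_forall_Qstar_le (hr : ∀ h < M.H, ∀ s a, M.r h s a ∈ Set.Icc (0 : ℝ) 1)
    {s : S} {c : ℝ} (hc : ∀ a, M.Qstar 0 s a ≤ c) : M.Vstar 0 s ≤ c := by
  have : Nonempty (Policy S A) := ⟨fun _ _ => Classical.arbitrary A⟩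
  refine ciSup_le fun π => le_trans ?_ (hc (π 0 s))
  have h1 := M.Q_le_valueIteration hr π M.H le_rfl s (π 0 s)
  rw [← M.Qstar_eq_valueIteration hr le_rfl, Nat.sub_self] at h1
  exact h1

end Optimality

/-- The Bellman residual `f_h - T_h f_{h+1}`. -/
noncomputable def residual (f : QFun S A) (h : ℕ) (x : S × A) : ℝ :=
  f h x.1 x.2 - M.bellman h (f (h + 1)) x.1 x.2

/-- A sequence of functions with values in `[0, 1]` that vanishes from the horizon on and whose
Bellman backups have values in `[0, 1]`. -/
structure Admissible (f : QFun S A) : Prop where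
  mem_Icc : ∀ h s a, f h s a ∈ Set.Icc (0 : ℝ) 1
  eq_zero : ∀ h, M.H ≤ h → f h = 0
  bellman_mem_Icc : ∀ h < M.H, ∀ s a, M.bellman h (f (h + 1)) s a ∈ Set.Icc (0 : ℝ) 1

variable {M}

theorem Admissible.abs_residual_le {f : QFun S A} (hf : M.Admissible f) {h : ℕ} (hh : h < M.H)
    (x : S × A) : |M.residual f h x| ≤ 1 := by
  have h1 := hf.mem_Icc h x.1 x.2
  have h2 := hf.bellman_mem_Icc h hh x.1 x.2
  rw [residual, abs_le]
  constructor <;> linarith [h1.1, h1.2, h2.1, h2.2]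

variable [Fintype A] [Nonempty A]

/-- Since `π` is greedy for `f`, the maximum in the Bellman backup is `f` at the action of `π`. Thus
`f - Q^π` satisfies the evaluation recursion of `π` with the residual as reward. -/
theorem Admissible.sub_Q_eq_sum {f : QFun S A} (hf : M.Admissible f)
    (hr : ∀ h < M.H, ∀ s a, M.r h s a ∈ Set.Icc (0 : ℝ) 1) {π : Policy S A}
    (hπ : ∀ h < M.H, ∀ s a, f h s a ≤ f h s (π h s)) : ∀ (n h : ℕ) (s : S) (a : A),
    h + n = M.H → f h s a - M.Q π h s a =
      ∑ k ∈ Finset.range n, (M.stepLaw π k h s a).expect (M.residual f (h + k))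
  | 0, h, s, a, hn => by
    simp [hf.eq_zero h (by omega), M.Q_of_horizon_le π (show M.H ≤ h by omega)]
  | n + 1, h, s, a, hn => by
    have hsup : ∀ s', ⨆ a', f (h + 1) s' a' = f (h + 1) s' (π (h + 1) s') := fun s' =>
      ciSup_eq_of_forall_le fun b => by
        by_cases hh : h + 1 < M.H
        · exact hπ _ hh s' b
        · simp [hf.eq_zero (h + 1) (by omega)]
    have hV : ∀ s', |M.V π (h + 1) s'| ≤ n := fun s' => by
      have := M.Q_mem_Icc hr π n (h + 1) s' (π (h + 1) s') (by omega)
      rw [V, abs_of_nonneg this.1]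
      exact this.2
    have hf1 : ∀ s', |f (h + 1) s' (π (h + 1) s')| ≤ 1 := fun s' =>
      abs_le_one_of_mem_Icc (hf.mem_Icc _ _ _)
    have hb : ∀ k ∈ Finset.range n, ∀ s', |(M.stepLaw π k (h + 1) s' (π (h + 1) s')).expect
        (M.residual f (h + 1 + k))| ≤ 1 := fun k hk s' => PMF.abs_expect_le _ fun x =>
      hf.abs_residual_le (by have := Finset.mem_range.1 hk; omega) x
    rw [Finset.sum_range_succ']
    have e : ∀ k ∈ Finset.range n, (M.stepLaw π (k + 1) h s a).expect (M.residual f (h + (k + 1)))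
        = (M.P h s a).expect fun s' => (M.stepLaw π k (h + 1) s' (π (h + 1) s')).expect
            (M.residual f (h + 1 + k)) := fun k hk => by
      rw [stepLaw, PMF.expect_bind_of_bounded _ _ fun x => hf.abs_residual_le
        (by have := Finset.mem_range.1 hk; omega) x, show h + (k + 1) = h + 1 + k by ring]
    rw [Finset.sum_congr rfl e, ← PMF.expect_sum _ _ hb, stepLaw, PMF.expect_pure, add_zero,
      residual, bellman_eq_expect, M.Q_succ hr π (by omega)]
    have e2 : (M.P h s a).expect (fun s' => ∑ k ∈ Finset.range n,
        (M.stepLaw π k (h + 1) s' (π (h + 1) s')).expect (M.residual f (h + 1 + k))) =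
        (M.P h s a).expect (fun s' => f (h + 1) s' (π (h + 1) s')) -
          (M.P h s a).expect (fun s' => M.V π (h + 1) s') := by
      rw [← PMF.expect_sub _ hf1 hV]
      refine PMF.expect_congr fun s' _ => ?_
      rw [← sub_Q_eq_sum hf hr hπ n (h + 1) s' _ (by omega), V]
    simp only [e2, hsup]
    ring

theorem Admissible.sub_V_eq_sum {f : QFun S A} (hf : M.Admissible f)
    (hr : ∀ h < M.H, ∀ s a, M.r h s a ∈ Set.Icc (0 : ℝ) 1) {π : Policy S A}
    (hπ : ∀ h < M.H, ∀ s a, f h s a ≤ f h s (π h s)) :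
    f 0 M.init (π 0 M.init) - M.V π 0 M.init =
      ∑ h ∈ Finset.range M.H, (M.visitLaw π h).expect (M.residual f h) := by
  rw [V, hf.sub_Q_eq_sum hr hπ M.H 0 M.init _ (by simp)]
  simp only [zero_add, visitLaw]

end RL.EpisodicMDP

/-! ### The exponential supermartingale of excess losses. -/

namespace PMF

theorem map_congr_of_mem_support {α β : Type*} {p : PMF α} {f g : α → β}
    (h : ∀ a ∈ p.support, f a = g a) : p.map f = p.map g := by
  rw [← bind_pure_comp, ← bind_pure_comp]
  ext b
  rw [bind_apply, bind_apply]
  refine tsum_congr fun a => ?_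
  by_cases ha : p a = 0
  · simp [ha]
  · simp [h a ha]

end PMF

theorem abs_ciSup_sub_ciSup_le {A : Type v} [Finite A] [Nonempty A] {f g : A → ℝ} {ε : ℝ}
    (h : ∀ a, |f a - g a| ≤ ε) : |(⨆ a, f a) - ⨆ a, g a| ≤ ε := by
  rw [abs_sub_le_iff, sub_le_iff_le_add, sub_le_iff_le_add]
  constructor
  · refine ciSup_le fun a => ?_
    have := le_ciSup (Set.finite_range g).bddAbove a
    linarith [(abs_le.1 (h a)).2]
  · refine ciSup_le fun a => ?_
    have := le_ciSup (Set.finite_range f).bddAbove a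
    linarith [(abs_le.1 (h a)).1]

namespace RL.EpisodicMDP

variable {S : Type u} {A : Type v} (M : EpisodicMDP S A)

/-- The excess squared loss of `f_h` over `T_h f_{h+1}` on a single sample. -/
noncomputable def stepExcess (f : QFun S A) (h : ℕ) (e : Step S A) : ℝ :=
  (f h e.state e.action - e.reward - ⨆ a', f (h + 1) e.next a') ^ 2 -
    (M.bellman h (f (h + 1)) e.state e.action - e.reward - ⨆ a', f (h + 1) e.next a') ^ 2

/-- The excess squared loss of `f_h` over `T_h f_{h+1}` on the sample of step `h` of an episode. -/
noncomputable def excess (f : QFun S A) (h : ℕ) (l : List (Step S A)) : ℝ :=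
  l[h]?.elim 0 (M.stepExcess f h)

theorem sum_map_excess (f : QFun S A) (h : ℕ) (D : List (List (Step S A))) :
    (D.map (M.excess f h)).sum = loss (dataset D h) (f h) (f (h + 1)) -
      loss (dataset D h) (M.bellman h (f (h + 1))) (f (h + 1)) := by
  induction D with
  | nil => simp [dataset, loss]
  | cons l D ih =>
    rw [List.map_cons, List.sum_cons, ih]
    cases hl : l[h]? with
    | none => simp [dataset, hl, excess]
    | some e =>
      simp only [dataset, List.filterMap_cons, hl, loss, List.map_cons, List.sum_cons, excess,
        Option.elim_some, stepExcess]
      ring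

/-- The accumulated value of `G` at the proper prefixes of a list. -/
noncomputable def prefixSum {α : Type*} (G : List α → ℝ) (D : List α) : ℝ :=
  ∑ i ∈ Finset.range D.length, G (D.take i)

theorem prefixSum_append_singleton {α : Type*} (G : List α → ℝ) (D : List α) (e : α) :
    prefixSum G (D ++ [e]) = prefixSum G D + G D := by
  rw [prefixSum, List.length_append, List.length_singleton, Finset.sum_range_succ, prefixSum]
  congr 1
  · refine Finset.sum_congr rfl fun i hi => ?_
    rw [List.take_append_of_le_length (Finset.mem_range.1 hi).le]
  · simp

/-- The compensator `G` depends only on past episodes, so it factors out of the average over the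
next one, and each new episode multiplies the expectation by at most 1. -/
theorem tsum_runLaw_mul_exp_le_one (greedy : QFun S A → Policy S A)
    (sel : List (List (Step S A)) → QFun S A) (G : List (List (Step S A)) → ℝ)
    (X : List (Step S A) → ℝ)
    (hX : ∀ D, ∑' e, M.episode (greedy (sel D)) e * ENNReal.ofReal (Real.exp (-X e)) ≤
      ENNReal.ofReal (Real.exp (-G D))) (t : ℕ) :
    ∑' D, M.runLaw greedy sel t D *
      ENNReal.ofReal (Real.exp (prefixSum G D - (D.map X).sum)) ≤ 1 := by
  induction t with
  | zero => simp [runLaw, prefixSum]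
  | succ t ih =>
    rw [runLaw, PMF.tsum_bind_mul]
    refine le_trans (ENNReal.tsum_le_tsum fun D => mul_le_mul_right ?_ _) ih
    rw [PMF.tsum_map_mul]
    calc ∑' e, M.episode (greedy (sel D)) e * ENNReal.ofReal
          (Real.exp (prefixSum G (D ++ [e]) - ((D ++ [e]).map X).sum))
        = ∑' e, M.episode (greedy (sel D)) e * ENNReal.ofReal (Real.exp (-X e)) *
            ENNReal.ofReal (Real.exp (prefixSum G D - (D.map X).sum + G D)) := by
          refine tsum_congr fun e => ?_
          rw [mul_assoc, ← ENNReal.ofReal_mul (Real.exp_nonneg _), ← Real.exp_add,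
            prefixSum_append_singleton]
          congr 3
          simp only [List.map_append, List.map_cons, List.map_nil, List.sum_append, List.sum_cons,
            List.sum_nil]
          ring
      _ ≤ ENNReal.ofReal (Real.exp (-G D)) *
            ENNReal.ofReal (Real.exp (prefixSum G D - (D.map X).sum + G D)) := by
          rw [ENNReal.tsum_mul_right]
          gcongr
          exact hX D
      _ = _ := by
          rw [← ENNReal.ofReal_mul (Real.exp_nonneg _), ← Real.exp_add]
          congr 2
          ring

theorem mem_support_runLaw {greedy : QFun S A → Policy S A}
    {sel : List (List (Step S A)) → QFun S A} {t : ℕ} {D : List (List (Step S A))}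
    (hD : D ∈ (M.runLaw greedy sel t).support) :
    D.length = t ∧ (∀ i ≤ t, D.take i ∈ (M.runLaw greedy sel i).support) ∧
      ∀ e ∈ D, ∃ π, e ∈ (M.episode π).support := by
  induction t generalizing D with
  | zero =>
    have hD' := hD
    simp only [runLaw, PMF.support_pure, Set.mem_singleton_iff] at hD
    subst hD
    refine ⟨rfl, fun i hi => ?_, by simp⟩
    rw [Nat.le_zero.1 hi]
    exact hD'
  | succ t ih =>
    have hD' := hD
    simp only [runLaw, PMF.mem_support_bind_iff, PMF.mem_support_map_iff] at hD
    obtain ⟨D, hD1, e, he, rfl⟩ := hD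
    obtain ⟨h1, h2, h3⟩ := ih hD1
    refine ⟨by simp [h1], fun i hi => ?_, fun e' he' => ?_⟩
    · rcases Nat.lt_or_ge t i with hti | hti
      · obtain rfl : i = t + 1 := by omega
        rwa [List.take_of_length_le (by simp [h1])]
      · rw [List.take_append_of_le_length (by omega)]
        exact h2 i hti
    · rcases List.mem_append.1 he' with he' | he'
      · exact h3 e' he'
      · rw [List.mem_singleton.1 he']
        exact ⟨_, he⟩

/-- Transfers tail bounds for a run of `t` episodes to the prefixes of a longer run. -/
theorem runLaw_map_take (greedy : QFun S A → Policy S A)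
    (sel : List (List (Step S A)) → QFun S A) (t k : ℕ) :
    (M.runLaw greedy sel (t + k)).map (List.take t) = M.runLaw greedy sel t := by
  induction k with
  | zero =>
    refine (PMF.map_congr_of_mem_support (g := id) fun D hD => ?_).trans (PMF.map_id _)
    exact List.take_of_length_le (M.mem_support_runLaw hD).1.le
  | succ k ih =>
    rw [← ih, ← add_assoc, runLaw, PMF.map_bind, ← PMF.bind_pure_comp]
    ext D'
    rw [PMF.bind_apply, PMF.bind_apply]
    refine tsum_congr fun D => ?_
    by_cases hD : M.runLaw greedy sel (t + k) D = 0
    · simp [hD]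
    · congr 2
      have hl := (M.mem_support_runLaw hD).1
      rw [PMF.map_comp, PMF.map_congr_of_mem_support (g := fun _ => D.take t)]
      · exact PMF.map_const _ _
      · intro e _
        exact List.take_append_of_le_length (by omega)

variable {M} [Fintype A] [Nonempty A]

theorem Admissible.iSup_mem_Icc {f : QFun S A} (hf : M.Admissible f) (h : ℕ) (s : S) :
    ⨆ a, f h s a ∈ Set.Icc (0 : ℝ) 1 :=
  ciSup_mem_Icc fun a => hf.mem_Icc h s a

theorem Admissible.abs_bellman_sub_le {f : QFun S A} (hf : M.Admissible f) (h : ℕ) (s : S) (a : A)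
    (s' : S) : |M.bellman h (f (h + 1)) s a - M.r h s a - ⨆ a', f (h + 1) s' a'| ≤ 1 := by
  have h1 := hf.iSup_mem_Icc (h + 1)
  have h2 := (M.P h s a).expect_nonneg fun s' => (h1 s').1
  have h3 := (M.P h s a).expect_le (fun s' => abs_le_one_of_mem_Icc (h1 s')) fun s' => (h1 s').2
  have h4 := h1 s'
  rw [bellman_eq_expect, abs_le]
  constructor <;> linarith [h4.1, h4.2]

/-- Given the pair, the excess is `δ² - 2δξ` with `ξ` centred and `|ξ| ≤ 1`. By `exp z ≤ 1 + z + z²`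
at `z = δξ/4`, the noise costs `δ²/16` of the available `δ²/8`. -/
theorem Admissible.tsum_mul_exp_stepExcess_le {f : QFun S A} (hf : M.Admissible f) {h : ℕ}
    (hh : h < M.H) (x : S × A) :
    ∑' s', M.P h x.1 x.2 s' * ENNReal.ofReal (Real.exp
      (-(M.stepExcess f h ⟨x.1, x.2, M.r h x.1 x.2, s'⟩ / 8))) ≤
      ENNReal.ofReal (Real.exp (-(M.residual f h x ^ 2 / 16))) := by
  set δ := M.residual f h x with hδ
  have hδ1 : |δ| ≤ 1 := hf.abs_residual_le hh x
  set v : S → ℝ := fun s' => ⨆ a', f (h + 1) s' a' with hv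
  set b := (M.P h x.1 x.2).expect v with hb
  have hv1 : ∀ s', |v s'| ≤ 1 := fun s' => abs_le_one_of_mem_Icc (hf.iSup_mem_Icc _ s')
  have hξ : ∀ s', |v s' - b| ≤ 1 := fun s' => by
    have := hf.abs_bellman_sub_le h x.1 x.2 s'
    rw [bellman_eq_expect, add_sub_cancel_left, abs_sub_comm] at this
    exact this
  have e1 : ∀ s', M.stepExcess f h ⟨x.1, x.2, M.r h x.1 x.2, s'⟩ =
      δ ^ 2 - 2 * δ * (v s' - b) := fun s' => by
    simp only [stepExcess, hδ, residual, bellman_eq_expect, hb, hv]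
    ring
  have hpt : ∀ s', Real.exp (-(M.stepExcess f h ⟨x.1, x.2, M.r h x.1 x.2, s'⟩ / 8)) ≤
      Real.exp (-(δ ^ 2 / 8)) * (1 + δ ^ 2 / 16 + δ / 4 * (v s' - b)) := fun s' => by
    rw [e1, show -((δ ^ 2 - 2 * δ * (v s' - b)) / 8) = -(δ ^ 2 / 8) + δ / 4 * (v s' - b) by ring,
      Real.exp_add]
    gcongr
    have hz : |δ / 4 * (v s' - b)| ≤ 1 := by
      rw [abs_mul, abs_div, abs_of_pos (four_pos : (0 : ℝ) < 4)]
      have := mul_le_one₀ hδ1 (abs_nonneg _) (hξ s')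
      linarith
    have h1 := (abs_le.1 (Real.abs_exp_sub_one_sub_id_le hz)).2
    have h2 : (v s' - b) ^ 2 ≤ 1 := by
      rw [← sq_abs]
      exact pow_le_one₀ (abs_nonneg _) (hξ s')
    nlinarith [sq_nonneg δ]
  have hnn : ∀ s', 0 ≤ Real.exp (-(δ ^ 2 / 8)) * (1 + δ ^ 2 / 16 + δ / 4 * (v s' - b)) :=
    fun s' => (Real.exp_nonneg _).trans (hpt s')
  have hz : ∀ s', |δ / 4 * (v s' - b)| ≤ 1 := fun s' => by
    rw [abs_mul, abs_div, abs_of_pos (four_pos : (0 : ℝ) < 4)]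
    have := mul_le_one₀ hδ1 (abs_nonneg _) (hξ s')
    linarith
  have hbd : ∀ s', |Real.exp (-(δ ^ 2 / 8)) * (1 + δ ^ 2 / 16 + δ / 4 * (v s' - b))| ≤
      Real.exp (-(δ ^ 2 / 8)) * (1 + δ ^ 2 / 16 + 1) := fun s' => by
    rw [abs_of_nonneg (hnn s')]
    gcongr
    exact (abs_le.1 (hz s')).2
  calc _ ≤ ∑' s', M.P h x.1 x.2 s' * ENNReal.ofReal
        (Real.exp (-(δ ^ 2 / 8)) * (1 + δ ^ 2 / 16 + δ / 4 * (v s' - b))) :=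
        ENNReal.tsum_le_tsum fun s' => by
          gcongr
          exact hpt s'
    _ = ENNReal.ofReal ((M.P h x.1 x.2).expect fun s' =>
          Real.exp (-(δ ^ 2 / 8)) * (1 + δ ^ 2 / 16 + δ / 4 * (v s' - b))) :=
        (PMF.ofReal_expect _ hnn hbd).symm
    _ ≤ _ := by
        apply ENNReal.ofReal_le_ofReal
        rw [PMF.expect_const_mul, PMF.expect_add _ (fun _ => le_refl |1 + δ ^ 2 / 16|) hz,
          PMF.expect_const, PMF.expect_const_mul, PMF.expect_sub _ hv1 (fun _ => le_refl |b|),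
          PMF.expect_const, ← hb, sub_self, mul_zero, add_zero]
        calc Real.exp (-(δ ^ 2 / 8)) * (1 + δ ^ 2 / 16)
            ≤ Real.exp (-(δ ^ 2 / 8)) * Real.exp (δ ^ 2 / 16) := by
              gcongr
              linarith [Real.add_one_le_exp (δ ^ 2 / 16)]
          _ = _ := by
              rw [← Real.exp_add]
              congr 1
              ring

/-- Moving the average over the visited pair into the exponent goes against Jensen. For `u = δ²/16`
one has `exp(-u) ≤ 1 - u/2`, which loses a factor 2: hence 32. -/
theorem Admissible.tsum_episode_mul_exp_excess_le {f : QFun S A} (hf : M.Admissible f) {h : ℕ}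
    (hh : h < M.H) (π : Policy S A) :
    ∑' e, M.episode π e * ENNReal.ofReal (Real.exp (-(M.excess f h e / 8))) ≤
      ENNReal.ofReal (Real.exp
        (-((M.visitLaw π h).expect (fun x => M.residual f h x ^ 2) / 32))) := by
  have hsq : ∀ x, |M.residual f h x ^ 2| ≤ 1 := fun x => by
    rw [abs_pow]
    exact pow_le_one₀ (abs_nonneg _) (hf.abs_residual_le hh x)
  have hsq' : ∀ x, |1 / 32 * M.residual f h x ^ 2| ≤ 1 / 32 := fun x => by
    rw [abs_mul, abs_of_pos (by norm_num : (0 : ℝ) < 1 / 32)]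
    linarith [hsq x]
  have hexp : ∀ x, |Real.exp (-(M.residual f h x ^ 2 / 16))| ≤ 1 := fun x => by
    rw [abs_of_nonneg (Real.exp_nonneg _)]
    exact Real.exp_le_one_iff.2 (by have := sq_nonneg (M.residual f h x); linarith)
  calc _ = ∑' o, (M.episode π).map (fun l => l[h]?) o *
        ENNReal.ofReal (Real.exp (-(o.elim 0 (M.stepExcess f h) / 8))) := by
        rw [PMF.tsum_map_mul]
        rfl
    _ = ∑' x, M.visitLaw π h x * ∑' s', M.P h x.1 x.2 s' * ENNReal.ofReal (Real.exp
          (-(M.stepExcess f h ⟨x.1, x.2, M.r h x.1 x.2, s'⟩ / 8))) := by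
        rw [M.episode_map_getElem? π hh, PMF.tsum_bind_mul]
        refine tsum_congr fun x => ?_
        rw [PMF.tsum_map_mul]
        rfl
    _ ≤ ∑' x, M.visitLaw π h x *
          ENNReal.ofReal (Real.exp (-(M.residual f h x ^ 2 / 16))) :=
        ENNReal.tsum_le_tsum fun x => by
          gcongr
          exact hf.tsum_mul_exp_stepExcess_le hh x
    _ = ENNReal.ofReal ((M.visitLaw π h).expect fun x =>
          Real.exp (-(M.residual f h x ^ 2 / 16))) :=
        (PMF.ofReal_expect _ (fun x => Real.exp_nonneg _) hexp).symm
    _ ≤ _ := by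
        apply ENNReal.ofReal_le_ofReal
        have hpt : ∀ x, Real.exp (-(M.residual f h x ^ 2 / 16)) ≤
            1 - 1 / 32 * M.residual f h x ^ 2 := fun x => by
          have h0 := sq_nonneg (M.residual f h x)
          have h1 := (abs_le.1 (hsq x)).2
          have h2 := (abs_le.1 (Real.abs_exp_sub_one_sub_id_le
            (x := -(M.residual f h x ^ 2 / 16)) (by rw [abs_le]; constructor <;> linarith))).2
          nlinarith
        have h1 : ∀ _ : S × A, |(1 : ℝ)| ≤ 1 := fun _ => by simp
        refine (PMF.expect_mono _ hexp (g := fun x => 1 - 1 / 32 * M.residual f h x ^ 2)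
          (C' := 2) (fun x => ?_) hpt).trans ?_
        · have := abs_sub (1 : ℝ) (1 / 32 * M.residual f h x ^ 2)
          rw [abs_one] at this
          linarith [hsq' x]
        · rw [PMF.expect_sub _ h1 hsq', PMF.expect_const, PMF.expect_const_mul]
          refine le_trans (le_of_eq ?_) (Real.add_one_le_exp _)
          ring

/-! ### Stability under uniform perturbation of `f`. -/

theorem Admissible.abs_bellman_sub_bellman_le {f g : QFun S A} {ε : ℝ} (hf : M.Admissible f)
    (hg : M.Admissible g) (hfg : ∀ h s a, |f h s a - g h s a| ≤ ε) (h : ℕ) (s : S) (a : A) :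
    |M.bellman h (f (h + 1)) s a - M.bellman h (g (h + 1)) s a| ≤ ε := by
  rw [bellman_eq_expect, bellman_eq_expect, add_sub_add_left_eq_sub, ← PMF.expect_sub _
    (fun s' => abs_le_one_of_mem_Icc (hf.iSup_mem_Icc _ s'))
    (fun s' => abs_le_one_of_mem_Icc (hg.iSup_mem_Icc _ s'))]
  exact PMF.abs_expect_le _ fun s' => abs_ciSup_sub_ciSup_le fun a' => hfg (h + 1) s' a'

theorem Admissible.abs_residual_sub_residual_le {f g : QFun S A} {ε : ℝ} (hf : M.Admissible f)
    (hg : M.Admissible g) (hfg : ∀ h s a, |f h s a - g h s a| ≤ ε) (h : ℕ) (x : S × A) :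
    |M.residual f h x - M.residual g h x| ≤ 2 * ε := by
  have h1 := abs_le.1 (hf.abs_bellman_sub_bellman_le hg hfg h x.1 x.2)
  have h2 := abs_le.1 (hfg h x.1 x.2)
  rw [residual, residual, abs_le]
  constructor <;> linarith

theorem Admissible.expect_residual_sq_le {f g : QFun S A} {ε : ℝ} (hf : M.Admissible f)
    (hg : M.Admissible g) (hfg : ∀ h s a, |f h s a - g h s a| ≤ ε) {h : ℕ} (hh : h < M.H) (p : PMF (S × A)) :
    p.expect (fun x => M.residual f h x ^ 2) ≤
      p.expect (fun x => M.residual g h x ^ 2) + 4 * ε := by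
  have hsq : ∀ {f : QFun S A}, M.Admissible f → ∀ x, |M.residual f h x ^ 2| ≤ 1 := fun hf x => by
    rw [abs_pow]
    exact pow_le_one₀ (abs_nonneg _) (hf.abs_residual_le hh x)
  rw [← PMF.expect_const p (4 * ε), ← PMF.expect_add p (hsq hg) (fun _ => le_refl |4 * ε|)]
  refine PMF.expect_mono p (hsq hf) (C' := 1 + |4 * ε|) (fun x => ?_) fun x => ?_
  · exact (abs_add_le _ _).trans (by gcongr; exact hsq hg x)
  · have h1 := hf.abs_residual_sub_residual_le hg hfg h x
    have h2 := (abs_add_le (M.residual f h x) (M.residual g h x)).trans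
      (add_le_add (hf.abs_residual_le hh x) (hg.abs_residual_le hh x))
    have h3 := mul_le_mul h1 h2 (abs_nonneg _) ((abs_nonneg _).trans h1)
    rw [← abs_mul] at h3
    have h4 := (abs_le.1 h3).2
    linarith

/-- The excess is `δ² + 2δη` with `|δ|, |η| ≤ 1`, each moving by at most `2ε`. The square
contributes `4ε`, the product `8ε`. -/
theorem Admissible.stepExcess_le {f g : QFun S A} {ε : ℝ} (hf : M.Admissible f)
    (hg : M.Admissible g) (hfg : ∀ h s a, |f h s a - g h s a| ≤ ε) {h : ℕ} (hh : h < M.H) {e : Step S A}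
    (he : e.reward = M.r h e.state e.action) :
    M.stepExcess f h e ≤ M.stepExcess g h e + 12 * ε := by
  have e1 : ∀ f : QFun S A, M.stepExcess f h e = M.residual f h (e.state, e.action) ^ 2 +
      2 * M.residual f h (e.state, e.action) * (M.bellman h (f (h + 1)) e.state e.action -
        M.r h e.state e.action - ⨆ a', f (h + 1) e.next a') := fun f => by
    rw [stepExcess, he, residual]
    ring
  have h1 := abs_le.1 (hf.abs_residual_sub_residual_le hg hfg h (e.state, e.action))
  have h2 := abs_le.1 (hf.abs_residual_le hh (e.state, e.action))
  have h3 := abs_le.1 (hg.abs_residual_le hh (e.state, e.action))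
  have h4 := abs_le.1 (hf.abs_bellman_sub_le h e.state e.action e.next)
  have h5 := abs_le.1 (hg.abs_bellman_sub_le h e.state e.action e.next)
  have h6 := abs_le.1 (hf.abs_bellman_sub_bellman_le hg hfg h e.state e.action)
  have h7 := abs_le.1 (abs_ciSup_sub_ciSup_le fun a' => hfg (h + 1) e.next a')
  have hε : 0 ≤ ε := by linarith [h6.1, h6.2]
  rw [e1 f, e1 g]
  set η := M.bellman h (f (h + 1)) e.state e.action -
        M.r h e.state e.action - ⨆ a', f (h + 1) e.next a' with hη
  set η' := M.bellman h (g (h + 1)) e.state e.action -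
        M.r h e.state e.action - ⨆ a', g (h + 1) e.next a' with hη'
  set δ := M.residual f h (e.state, e.action)
  set δ' := M.residual g h (e.state, e.action)
  have h8 : |η - η'| ≤ 2 * ε := by
    rw [abs_le]
    constructor <;> linarith
  have prod : ∀ {x y a b : ℝ}, |x| ≤ a → |y| ≤ b → x * y ≤ a * b := fun {x y a b} hx hy =>
    (le_abs_self _).trans ((abs_mul x y).trans_le
      (mul_le_mul hx hy (abs_nonneg _) ((abs_nonneg _).trans hx)))
  have p1 := prod (x := δ - δ') (y := δ + δ') (abs_le.2 h1) (b := 2)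
    (abs_le.2 ⟨by linarith, by linarith⟩)
  have p2 := prod (x := δ) (y := η - η') (abs_le.2 h2) h8
  have p3 := prod (x := δ - δ') (y := η') (abs_le.2 h1) (abs_le.2 h5)
  linarith

theorem Admissible.excess_le {f g : QFun S A} {ε : ℝ} (hf : M.Admissible f)
    (hg : M.Admissible g) (hfg : ∀ h s a, |f h s a - g h s a| ≤ ε) {h : ℕ} (hh : h < M.H) {π : Policy S A} {l : List (Step S A)}
    (hl : l ∈ (M.episode π).support) : M.excess f h l ≤ M.excess g h l + 12 * ε := by
  rw [excess, excess]
  cases hlh : l[h]? with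
  | none =>
    have := (abs_nonneg _).trans (hf.abs_bellman_sub_bellman_le hg hfg h M.init
      (Classical.arbitrary A))
    simpa using this
  | some e =>
    have := M.reward_eq_of_mem_support_rollout π M.H 0 M.init _ l hl h e hlh
    rw [zero_add] at this
    exact hf.stepExcess_le hg hfg hh this

end RL.EpisodicMDP

/-! ### Coverability and its comparison with the `L^p` coefficient. -/

namespace RL.EpisodicMDP

theorem ratioNorm_le {X : Type*} {p : ℝ} (hp : 0 ≤ p) {ρ : X → ℝ≥0∞} {μ : PMF X} {c : ℝ≥0∞}
    (h : ∀ x, ρ x ≤ c * μ x) : ratioNorm p ρ μ ≤ c ^ p := by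
  rw [ratioNorm, if_pos fun x hx => by simpa [hx] using h x]
  refine PMF.tsum_mul_le_of_le μ _ _ fun x => ?_
  gcongr
  exact ENNReal.div_le_of_le_mul (h x)

/-- A single term of the series is at most its sum; solve it for `ρ x`. Finiteness of `C` excludes
the singular branch. -/
theorem le_of_ratioNorm_le {X : Type*} {p : ℝ} (hp : 1 ≤ p) {ρ : X → ℝ≥0∞} {μ : PMF X}
    {C : ℝ≥0∞} (hC : C ≠ ⊤) (h : ratioNorm p ρ μ ≤ C) (x : X) :
    ρ x ≤ C ^ (1 / p) * μ x ^ (1 - 1 / p) := by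
  have hp0 : 0 < p := by linarith
  rw [ratioNorm] at h
  split_ifs at h with hac
  · by_cases hx : μ x = 0
    · simp [hac x hx]
    · have hx' : μ x ≠ ⊤ := μ.apply_ne_top x
      have h1 : μ x * (ρ x / μ x) ^ p ≤ C := (ENNReal.le_tsum x).trans h
      have h2 : (ρ x / μ x) ^ p ≤ C / μ x := by
        rw [ENNReal.le_div_iff_mul_le (Or.inl hx) (Or.inl hx'), mul_comm]
        exact h1
      have h3 : ρ x / μ x ≤ (C / μ x) ^ (1 / p) := by
        rw [one_div]
        exact (ENNReal.le_rpow_inv_iff hp0).2 h2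
      calc ρ x = ρ x / μ x * μ x := (ENNReal.div_mul_cancel hx hx').symm
        _ ≤ (C / μ x) ^ (1 / p) * μ x := by gcongr
        _ = _ := by
            rw [ENNReal.div_rpow_of_nonneg _ _ (by positivity), ENNReal.rpow_sub _ _ hx hx',
              ENNReal.rpow_one, ENNReal.div_eq_inv_mul, ENNReal.div_eq_inv_mul, mul_comm _ (C ^ _),
              mul_assoc]
  · exact absurd (top_le_iff.1 h) hC

variable {S : Type u} {A : Type v} (M : EpisodicMDP S A)

/-- The coverability coefficient `max_h ∑_{s, a} sup_{π ∈ Pol} ρ_h^π(s, a)`. -/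
noncomputable def coverability (Pol : Set (Policy S A)) : ℝ≥0∞ :=
  ⨆ h < M.H, ∑' x, ⨆ π ∈ Pol, M.occupancy π h x

theorem tsum_iSup_occupancy_le_coverability (Pol : Set (Policy S A)) {h : ℕ} (hh : h < M.H) :
    ∑' x, ⨆ π ∈ Pol, M.occupancy π h x ≤ M.coverability Pol :=
  le_iSup₂ (f := fun h (_ : h < M.H) => ∑' x, ⨆ π ∈ Pol, M.occupancy π h x) h hh

theorem one_le_coverability (hH : 1 ≤ M.H) {Pol : Set (Policy S A)} {π : Policy S A}
    (hπ : π ∈ Pol) : 1 ≤ M.coverability Pol :=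
  calc (1 : ℝ≥0∞) = ∑' x, M.visitLaw π 0 x := (PMF.tsum_coe _).symm
    _ ≤ ∑' x, ⨆ π ∈ Pol, M.occupancy π 0 x := ENNReal.tsum_le_tsum fun x => by
        rw [← M.occupancy_eq_visitLaw π hH]
        exact le_iSup₂ (f := fun π (_ : π ∈ Pol) => M.occupancy π 0 x) π hπ
    _ ≤ _ := M.tsum_iSup_occupancy_le_coverability Pol hH

theorem coverability_le_rpow_mul {Pol : Set (Policy S A)} {p : ℝ} (hp : 1 ≤ p)
    {μ : ℕ → PMF (S × A)} (hcov : M.coverage Pol p μ ≠ ⊤) {B : ℝ≥0∞}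
    (hB : ∀ h < M.H, ∑' x, (μ h x) ^ (min (1 / 2) (1 - 1 / p) : ℝ) ≤ B) :
    M.coverability Pol ≤ M.coverage Pol p μ ^ (1 / p) * B := by
  refine iSup₂_le fun h hh => ?_
  calc ∑' x, ⨆ π ∈ Pol, M.occupancy π h x
      ≤ ∑' x, M.coverage Pol p μ ^ (1 / p) * (μ h x) ^ (min (1 / 2) (1 - 1 / p) : ℝ) := by
        refine ENNReal.tsum_le_tsum fun x => iSup₂_le fun π hπ => ?_
        have h1 : ratioNorm p (M.occupancy π h) (μ h) ≤ M.coverage Pol p μ :=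
          (le_iSup₂ (f := fun h (_ : h < M.H) => ratioNorm p (M.occupancy π h) (μ h)) h hh).trans
            (le_iSup₂ (f := fun π (_ : π ∈ Pol) => ⨆ h < M.H,
              ratioNorm p (M.occupancy π h) (μ h)) π hπ)
        refine (le_of_ratioNorm_le hp hcov h1 x).trans ?_
        gcongr 1
        -- Since `μ ≤ 1`, lowering the exponent to the minimum only increases the power.
        exact ENNReal.rpow_le_rpow_of_exponent_ge ((μ h).coe_le_one x) (min_le_right _ _)
    _ ≤ _ := by
        rw [ENNReal.tsum_mul_left]
        gcongr
        exact hB h hh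

theorem Ccw_ne_zero (hH : 1 ≤ M.H) {Pol : Set (Policy S A)} {p : ℝ} (hp : 1 ≤ p)
    {μ : ℕ → PMF (S × A)} (hμ : M.coverage Pol p μ = M.Ccw Pol p) {π : Policy S A}
    (hπ : π ∈ Pol) : M.Ccw Pol p ≠ 0 := by
  intro h0
  -- The trivial bound `⊤` suffices because `0 * ⊤ = 0`; coverability would vanish although it is at
  -- least 1.
  have h1 := M.coverability_le_rpow_mul hp (μ := μ) (B := ⊤) (Pol := Pol) (by simp [hμ, h0])
    fun _ _ => le_top
  rw [hμ, h0, ENNReal.zero_rpow_of_pos (by positivity), zero_mul] at h1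
  exact absurd ((M.one_le_coverability hH hπ).trans h1) (by simp)

variable [Fintype A] [Nonempty A]

/-- The law of the state-action pair reached after `k` transitions when action `a` is taken in
state `s` at step `h`, and all later actions are uniformly random. -/
noncomputable def uniformStepLaw : ℕ → ℕ → S → A → PMF (S × A)
  | 0, _, s, a => PMF.pure (s, a)
  | k + 1, h, s, a => (M.P h s a).bind fun s' =>
      (PMF.uniformOfFintype A).bind fun a' => uniformStepLaw k (h + 1) s' a'

theorem le_card_mul_uniformOfFintype_bind {X : Type*} (q : A → PMF X) (a : A) (x : X) :
    q a x ≤ Fintype.card A * (PMF.uniformOfFintype A).bind q x := by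
  rw [PMF.bind_apply]
  simp only [PMF.uniformOfFintype_apply]
  rw [ENNReal.tsum_mul_left, ← mul_assoc, ENNReal.mul_inv_cancel (by simp) (by simp), one_mul]
  exact ENNReal.le_tsum a

/-- A uniform action agrees with that of `π` with probability `1/|A|`, so each transition costs a
factor `|A|`. The dominating law does not depend on `π`. -/
theorem stepLaw_le_uniformStepLaw (π : Policy S A) : ∀ (k h : ℕ) (s : S) (a : A) (x : S × A),
    M.stepLaw π k h s a x ≤ (Fintype.card A : ℝ≥0∞) ^ k * M.uniformStepLaw k h s a x
  | 0, h, s, a, x => by simp [stepLaw, uniformStepLaw]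
  | k + 1, h, s, a, x => by
    rw [stepLaw, uniformStepLaw, PMF.bind_apply, PMF.bind_apply, ← ENNReal.tsum_mul_left]
    refine ENNReal.tsum_le_tsum fun s' => ?_
    rw [mul_left_comm]
    gcongr
    refine (stepLaw_le_uniformStepLaw π k (h + 1) s' _ x).trans ?_
    rw [pow_succ, mul_assoc]
    gcongr
    exact le_card_mul_uniformOfFintype_bind (fun a' => M.uniformStepLaw k (h + 1) s' a') _ x

theorem occupancy_le_uniform (π : Policy S A) {h : ℕ} (hh : h < M.H) (x : S × A) :
    M.occupancy π h x ≤ (Fintype.card A : ℝ≥0∞) ^ M.H *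
      (PMF.uniformOfFintype A).bind (M.uniformStepLaw h 0 M.init) x := by
  rw [M.occupancy_eq_visitLaw π hh]
  refine (M.stepLaw_le_uniformStepLaw π h 0 M.init _ x).trans ?_
  calc _ ≤ (Fintype.card A : ℝ≥0∞) ^ h * (Fintype.card A *
        (PMF.uniformOfFintype A).bind (M.uniformStepLaw h 0 M.init) x) := by
        gcongr
        exact le_card_mul_uniformOfFintype_bind _ _ x
    _ ≤ _ := by
        rw [← mul_assoc, ← pow_succ]
        gcongr
        · exact_mod_cast Fintype.card_pos
        · exact hh

theorem coverability_ne_top (Pol : Set (Policy S A)) : M.coverability Pol ≠ ⊤ := by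
  refine ne_top_of_le_ne_top (b := (Fintype.card A : ℝ≥0∞) ^ M.H) (by finiteness) ?_
  refine iSup₂_le fun h hh => ?_
  calc _ ≤ ∑' x, (Fintype.card A : ℝ≥0∞) ^ M.H *
        (PMF.uniformOfFintype A).bind (M.uniformStepLaw h 0 M.init) x :=
        ENNReal.tsum_le_tsum fun x => iSup₂_le fun π _ => M.occupancy_le_uniform π hh x
    _ = _ := by rw [ENNReal.tsum_mul_left, PMF.tsum_coe, mul_one]

theorem Ccw_ne_top (Pol : Set (Policy S A)) {p : ℝ} (hp : 0 ≤ p) : M.Ccw Pol p ≠ ⊤ := by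
  refine ne_top_of_le_ne_top (b := ((Fintype.card A : ℝ≥0∞) ^ M.H) ^ p) ?_ ?_
  · exact ENNReal.rpow_ne_top_of_nonneg hp (by finiteness)
  · refine (iInf_le _ fun h => (PMF.uniformOfFintype A).bind (M.uniformStepLaw h 0 M.init)).trans ?_
    exact iSup₂_le fun π _ => iSup₂_le fun h hh =>
      ratioNorm_le hp fun x => M.occupancy_le_uniform π hh x

end RL.EpisodicMDP

/-! ### Uniform concentration over the function class. -/

theorem List.sum_map_le_add_of_forall_le {α : Type*} {φ ψ : α → ℝ} {c : ℝ} {l : List α}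
    (h : ∀ a ∈ l, φ a ≤ ψ a + c) : (l.map φ).sum ≤ (l.map ψ).sum + l.length * c := by
  induction l with
  | nil => simp
  | cons a l ih =>
    have h1 := ih fun b hb => h b (List.mem_cons_of_mem a hb)
    have h2 := h a List.mem_cons_self
    simp only [List.map_cons, List.sum_cons, List.length_cons]
    push_cast
    linarith

namespace RL.EpisodicMDP

variable {S : Type u} {A : Type v} (M : EpisodicMDP S A)

/-- The accumulated mean squared Bellman residual of `f` at step `h`, minus the accumulated excess
loss, scaled so that its exponential is a supermartingale. -/
noncomputable def deviation (greedy : QFun S A → Policy S A)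
    (sel : List (List (Step S A)) → QFun S A) (f : QFun S A) (h : ℕ)
    (D : List (List (Step S A))) : ℝ :=
  prefixSum (fun D => (M.visitLaw (greedy (sel D)) h).expect (fun x => M.residual f h x ^ 2) / 32) D
    - (D.map fun l => M.excess f h l / 8).sum

theorem sum_map_excess_div (f : QFun S A) (h : ℕ) (D : List (List (Step S A))) :
    (D.map fun l => M.excess f h l / 8).sum = (loss (dataset D h) (f h) (f (h + 1)) -
      loss (dataset D h) (M.bellman h (f (h + 1))) (f (h + 1))) / 8 := by
  rw [← sum_map_excess]
  simp only [div_eq_mul_inv]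
  exact List.sum_map_mul_right ..

/-- Arbitrary centres need not be admissible, so each is replaced by a class member from its ball,
doubling the radius. -/
theorem exists_net {𝓕 : Set (QFun S A)} (h𝓕 : 𝓕.Nonempty) {ε : ℝ} {N : ℕ}
    (hN : M.coveringNumber 𝓕 ε = N) : ∃ C : Finset (QFun S A), C.card ≤ N ∧ (∀ g ∈ C, g ∈ 𝓕) ∧
      ∀ f ∈ 𝓕, ∃ g ∈ C, ∀ h < M.H, ∀ s a, |f h s a - g h s a| ≤ 2 * ε := by
  classical
  obtain ⟨f₀, hf₀⟩ := h𝓕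
  have hlt : M.coveringNumber 𝓕 ε < (N + 1 : ℕ) := by
    rw [hN]
    exact_mod_cast Nat.lt_succ_self N
  rw [coveringNumber, iInf_lt_iff] at hlt
  obtain ⟨C, hlt⟩ := hlt
  rw [iInf_lt_iff] at hlt
  obtain ⟨hC, hlt⟩ := hlt
  have hcard : C.card ≤ N := Nat.lt_succ_iff.1 (by exact_mod_cast hlt)
  have hrep : ∀ c : QFun S A, ∃ g ∈ 𝓕, (∃ f ∈ 𝓕, ∀ h < M.H, ∀ s a, |f h s a - c h s a| ≤ ε) →
      ∀ h < M.H, ∀ s a, |g h s a - c h s a| ≤ ε := fun c => by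
    by_cases hc : ∃ f ∈ 𝓕, ∀ h < M.H, ∀ s a, |f h s a - c h s a| ≤ ε
    · obtain ⟨f, hf, hfc⟩ := hc
      exact ⟨f, hf, fun _ => hfc⟩
    · exact ⟨f₀, hf₀, fun h => absurd h hc⟩
  choose rep hrep1 hrep2 using hrep
  refine ⟨C.image rep, Finset.card_image_le.trans hcard, fun g hg => ?_, fun f hf => ?_⟩
  · obtain ⟨c, -, rfl⟩ := Finset.mem_image.1 hg
    exact hrep1 c
  · obtain ⟨c, hc, hfc⟩ := hC f hf
    refine ⟨rep c, Finset.mem_image_of_mem rep hc, fun h hh s a => ?_⟩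
    have h1 := abs_le.1 (hfc h hh s a)
    have h2 := abs_le.1 (hrep2 c ⟨f, hf, hfc⟩ h hh s a)
    rw [abs_le]
    constructor <;> linarith

theorem update_mem_classOf {F : ℕ → Set (S → A → ℝ)} {f : QFun S A} (hf : f ∈ M.classOf F) {h : ℕ}
    (hh : h < M.H) {g : S → A → ℝ} (hg : g ∈ F h) : Function.update f h g ∈ M.classOf F := by
  refine ⟨fun k hk => ?_, fun k hk => ?_⟩
  · by_cases hkh : k = h
    · subst hkh
      simpa using hg
    · rw [Function.update_of_ne hkh]
      exact hf.1 k hk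
  · rw [Function.update_of_ne (by omega)]
    exact hf.2 k hk

theorem bellman_mem_of_mem_classOf {F : ℕ → Set (S → A → ℝ)} (hB : M.BellmanComplete F)
    {f : QFun S A} (hf : f ∈ M.classOf F) {h : ℕ} (hh : h < M.H) :
    M.bellman h (f (h + 1)) ∈ F h := by
  rcases Nat.lt_or_ge (h + 1) M.H with h1 | h1
  · exact hB.1 h h1 _ (hf.1 _ h1)
  · rw [hf.2 _ h1]
    exact hB.2 h (by omega)

theorem admissible_of_mem_classOf {F : ℕ → Set (S → A → ℝ)} (hU : M.UnitRange F)
    (hB : M.BellmanComplete F) {f : QFun S A} (hf : f ∈ M.classOf F) : M.Admissible f where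
  mem_Icc h s a := by
    rcases Nat.lt_or_ge h M.H with h1 | h1
    · exact hU h h1 _ (hf.1 h h1) s a
    · simp [hf.2 h h1]
  eq_zero := hf.2
  bellman_mem_Icc h hh := hU h hh _ (M.bellman_mem_of_mem_classOf hB hf hh)

theorem Qstar_mem_classOf {F : ℕ → Set (S → A → ℝ)} (hR : M.Realizable F) :
    M.Qstar ∈ M.classOf F :=
  ⟨hR, fun _ hh => M.Qstar_of_horizon_le hh⟩

variable {M} [Fintype A] [Nonempty A]

/-- A Bellman backup is at most 1 and exceeds the reward by a non-negative term. This bounds rewards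
at unreachable pairs too. -/
theorem Admissible.reward_mem_Icc (hM : M.Normalized) {f : QFun S A} (hf : M.Admissible f) :
    ∀ h < M.H, ∀ s a, M.r h s a ∈ Set.Icc (0 : ℝ) 1 := fun h hh s a => by
  refine ⟨hM.reward_nonneg h hh s a, le_trans ?_ (hf.bellman_mem_Icc h hh s a).2⟩
  rw [bellman_eq_expect]
  have := (M.P h s a).expect_nonneg fun s' => (hf.iSup_mem_Icc (h + 1) s').1
  linarith

theorem Admissible.toOuterMeasure_deviation_le {f : QFun S A} (hf : M.Admissible f)
    (greedy : QFun S A → Policy S A) (sel : List (List (Step S A)) → QFun S A) {h : ℕ}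
    (hh : h < M.H) (t : ℕ) (ℓ : ℝ) :
    (M.runLaw greedy sel t).toOuterMeasure {D | ℓ < M.deviation greedy sel f h D} ≤
      ENNReal.ofReal (Real.exp (-ℓ)) :=
  PMF.toOuterMeasure_le_of_tsum_mul_le_one _ _ _ (M.tsum_runLaw_mul_exp_le_one greedy sel _ _
    (fun _ => hf.tsum_episode_mul_exp_excess_le hh _) t)

theorem toOuterMeasure_exists_deviation_le {C : Finset (QFun S A)} (hC : ∀ g ∈ C, M.Admissible g)
    (greedy : QFun S A → Policy S A) (sel : List (List (Step S A)) → QFun S A) (T : ℕ) (ℓ : ℝ) :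
    (M.runLaw greedy sel T).toOuterMeasure
      {D | ∃ t < T, ∃ h < M.H, ∃ g ∈ C, ℓ < M.deviation greedy sel g h (List.take t D)} ≤
      ENNReal.ofReal (C.card * T * M.H * Real.exp (-ℓ)) := by
  have hset : {D | ∃ t < T, ∃ h < M.H, ∃ g ∈ C, ℓ < M.deviation greedy sel g h (List.take t D)} =
      ⋃ i ∈ Finset.range T ×ˢ Finset.range M.H ×ˢ C,
        {D | ℓ < M.deviation greedy sel i.2.2 i.2.1 (List.take i.1 D)} := by
    ext D
    simp only [Set.mem_ofPred_eq, Set.mem_iUnion, Finset.mem_product, Finset.mem_range, Prod.exists]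
    constructor
    · rintro ⟨t, ht, h, hh, g, hg, hd⟩
      exact ⟨t, h, g, ⟨ht, hh, hg⟩, hd⟩
    · rintro ⟨t, h, g, ⟨ht, hh, hg⟩, hd⟩
      exact ⟨t, ht, h, hh, g, hg, hd⟩
  rw [hset]
  refine (MeasureTheory.measure_biUnion_finset_le _ _).trans ?_
  refine (Finset.sum_le_card_nsmul _ _ (ENNReal.ofReal (Real.exp (-ℓ))) fun i hi => ?_).trans ?_
  · simp only [Finset.mem_product, Finset.mem_range] at hi
    have := (hC _ hi.2.2).toOuterMeasure_deviation_le greedy sel hi.2.1 i.1 ℓ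
    rw [← M.runLaw_map_take greedy sel i.1 (T - i.1), PMF.toOuterMeasure_map_apply,
      Nat.add_sub_cancel' hi.1.le] at this
    exact this
  · rw [Finset.card_product, Finset.card_product, Finset.card_range, Finset.card_range,
      nsmul_eq_mul, ENNReal.ofReal_mul (by positivity)]
    gcongr
    rw [← ENNReal.ofReal_natCast]
    apply ENNReal.ofReal_le_ofReal
    push_cast
    exact le_of_eq (by ring)

/-- Per episode the excess contributes `12ε/8` and the squared residual `4ε/32`, together `13ε/8`.
-/
theorem Admissible.deviation_le {f g : QFun S A} {ε : ℝ} (hf : M.Admissible f)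
    (hg : M.Admissible g) (hfg : ∀ h s a, |f h s a - g h s a| ≤ ε)
    {greedy : QFun S A → Policy S A} {sel : List (List (Step S A)) → QFun S A} {h : ℕ}
    (hh : h < M.H) {t : ℕ} {D : List (List (Step S A))}
    (hD : D ∈ (M.runLaw greedy sel t).support) :
    M.deviation greedy sel f h D ≤ M.deviation greedy sel g h D + t * (13 / 8 * ε) := by
  obtain ⟨hlen, -, hep⟩ := M.mem_support_runLaw hD
  have hgf : ∀ h s a, |g h s a - f h s a| ≤ ε := fun h s a => by
    rw [abs_sub_comm]
    exact hfg h s a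
  have h1 : (D.map fun l => M.excess g h l / 8).sum ≤
      (D.map fun l => M.excess f h l / 8).sum + D.length * (3 / 2 * ε) :=
    List.sum_map_le_add_of_forall_le fun l hl => by
      obtain ⟨π, hπ⟩ := hep l hl
      have := hg.excess_le hf hgf hh hπ
      linarith
  have h2 : prefixSum (fun D => (M.visitLaw (greedy (sel D)) h).expect
        (fun x => M.residual f h x ^ 2) / 32) D ≤
      prefixSum (fun D => (M.visitLaw (greedy (sel D)) h).expect
        (fun x => M.residual g h x ^ 2) / 32) D + D.length * (1 / 8 * ε) := by
    have hsum : (D.length : ℝ) * (1 / 8 * ε) = ∑ _i ∈ Finset.range D.length, 1 / 8 * ε := by simp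
    rw [prefixSum, prefixSum, hsum, ← Finset.sum_add_distrib]
    refine Finset.sum_le_sum fun i _ => ?_
    have := hf.expect_residual_sq_le hg hfg hh (M.visitLaw (greedy (sel (D.take i))) h)
    linarith
  rw [hlen] at h1 h2
  rw [deviation, deviation]
  linarith

end RL.EpisodicMDP

/-! ### Optimism and the regret of GOLF. -/

namespace RL.EpisodicMDP

variable {S : Type u} {A : Type v} {M : EpisodicMDP S A} {F : ℕ → Set (S → A → ℝ)}
  {greedy : QFun S A → Policy S A} {sel : List (List (Step S A)) → QFun S A}

/-- Completeness makes the Bellman backup a competitor in the confidence condition, so the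
accumulated excess is at most `β`; the bound is `32 (c + β/8)`. -/
theorem sum_expect_residual_sq_le (hB : M.BellmanComplete F) {β c : ℝ}
    {D : List (List (Step S A))} {f : QFun S A} (hf : f ∈ M.confidenceSet F β D) {h : ℕ}
    (hh : h < M.H) (hD : M.deviation greedy sel f h D ≤ c) :
    ∑ i ∈ Finset.range D.length, (M.visitLaw (greedy (sel (D.take i))) h).expect
      (fun x => M.residual f h x ^ 2) ≤ 4 * β + 32 * c := by
  have h1 := hf.2 h hh _ (M.bellman_mem_of_mem_classOf hB hf.1 hh)
  rw [deviation, sum_map_excess_div, prefixSum, ← Finset.sum_div] at hD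
  linarith

variable [Fintype A] [Nonempty A]

/-- Replace the component of `Q^⋆` at step `h` by a competitor `g`. Its backup target is still
`Q^⋆_h`, so the excess is the loss of `g` minus that of `Q^⋆_h`, and small deviation keeps it above
`-8c`. -/
theorem Qstar_mem_confidenceSet (hR : M.Realizable F)
    (hr : ∀ h < M.H, ∀ s a, M.r h s a ∈ Set.Icc (0 : ℝ) 1) {β c : ℝ} (hβ : 8 * c ≤ β)
    {D : List (List (Step S A))}
    (hD : ∀ f ∈ M.classOf F, ∀ h < M.H, M.deviation greedy sel f h D ≤ c) :
    M.Qstar ∈ M.confidenceSet F β D := by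
  have hQ := M.Qstar_mem_classOf hR
  refine ⟨hQ, fun h hh g hg => ?_⟩
  have h1 := hD _ (M.update_mem_classOf hQ hh hg) h hh
  rw [deviation, sum_map_excess_div, Function.update_self,
    Function.update_of_ne (Nat.succ_ne_self h), M.bellman_Qstar hr hh] at h1
  have h2 : 0 ≤ prefixSum (fun D => (M.visitLaw (greedy (sel D)) h).expect
      (fun x => M.residual (Function.update M.Qstar h g) h x ^ 2) / 32) D :=
    Finset.sum_nonneg fun i _ => div_nonneg (PMF.expect_nonneg _ fun x => sq_nonneg _) (by norm_num)
  linarith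

theorem Vstar_le_of_mem_confidenceSet (hR : M.Realizable F)
    (hr : ∀ h < M.H, ∀ s a, M.r h s a ∈ Set.Icc (0 : ℝ) 1) (hH : 1 ≤ M.H)
    (hgr : M.IsGreedyRule (M.classOf F) greedy) {β : ℝ} {D : List (List (Step S A))}
    (hQ : M.Qstar ∈ M.confidenceSet F β D)
    (hsel : ∀ f ∈ M.confidenceSet F β D,
      f 0 M.init (greedy f 0 M.init) ≤ sel D 0 M.init (greedy (sel D) 0 M.init)) :
    M.Vstar 0 M.init ≤ sel D 0 M.init (greedy (sel D) 0 M.init) :=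
  M.Vstar_le_of_forall_Qstar_le hr fun a =>
    (hgr _ (M.Qstar_mem_classOf hR) 0 hH M.init a).trans (hsel _ hQ)

theorem sum_expect_residual_le {Pol : Set (Policy S A)} {π : ℕ → Policy S A} {f : ℕ → QFun S A}
    {T : ℕ} (hT : 1 ≤ T) (hπ : ∀ t < T, π t ∈ Pol) (hf : ∀ t < T, M.Admissible (f t)) {h : ℕ}
    (hh : h < M.H) {R η : ℝ} (hη : 0 < η)
    (hR : ∀ t < T, ∑ i ∈ Finset.range t, (M.visitLaw (π i) h).expect
      (fun x => M.residual (f t) h x ^ 2) ≤ R) :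
    ∑ t ∈ Finset.range T, (M.visitLaw (π t) h).expect (M.residual (f t) h) ≤
      2 * (M.coverability Pol).toReal + η * ((M.coverability Pol).toReal * Real.log T) +
        T * R / (2 * η) := by
  have hle := M.tsum_iSup_occupancy_le_coverability Pol hh
  have hne := M.coverability_ne_top Pol
  have hne' := ne_top_of_le_ne_top hne hle
  refine PMF.sum_expect_le_potential (m := fun x => (⨆ π ∈ Pol, M.occupancy π h x).toReal) hT
    (fun t ht x => ?_) (ENNReal.summable_toReal hne') ?_
    (fun t ht x => (hf t ht).abs_residual_le hh x) hη hR
  · refine ENNReal.toReal_mono (ENNReal.ne_top_of_tsum_ne_top hne' x) ?_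
    rw [← M.occupancy_eq_visitLaw _ hh]
    exact le_iSup₂ (f := fun π (_ : π ∈ Pol) => M.occupancy π h x) (π t) (hπ t ht)
  · rw [← ENNReal.tsum_toReal_eq (ENNReal.ne_top_of_tsum_ne_top hne')]
    exact ENNReal.toReal_mono hne hle

/-- The regret bound on the event that all deviations are small. -/
theorem regret_le_of_forall_deviation_le (hM : M.Normalized) {Pol : Set (Policy S A)}
    (hU : M.UnitRange F) (hR : M.Realizable F) (hB : M.BellmanComplete F)
    (hgr : M.IsGreedyRule (M.classOf F) greedy) (hPol : ∀ f ∈ M.classOf F, greedy f ∈ Pol)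
    {T : ℕ} (hT : 2 ≤ T) {β c : ℝ} (hβ : 2 ≤ β) (hc : 8 * c ≤ β)
    (hsel : M.IsGOLF F greedy β T sel) {D : List (List (Step S A))}
    (hD : D ∈ (M.runLaw greedy sel T).support)
    (hdev : ∀ t < T, ∀ f ∈ M.classOf F, ∀ h < M.H,
      M.deviation greedy sel f h (D.take t) ≤ c) :
    M.regret greedy sel T D ≤
      7 * (M.H * √((M.coverability Pol).toReal * (β * T * Real.log T))) := by
  have hadm : ∀ f ∈ M.classOf F, M.Admissible f := fun f => M.admissible_of_mem_classOf hU hB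
  have hQ := M.Qstar_mem_classOf hR
  have hr := (hadm _ hQ).reward_mem_Icc hM
  have hH := hM.horizon_pos
  have hrun := (M.mem_support_runLaw hD).2.1
  have hlen : ∀ t < T, (D.take t).length = t := fun t ht =>
    (M.mem_support_runLaw (hrun t ht.le)).1
  have hQc : ∀ t < T, M.Qstar ∈ M.confidenceSet F β (D.take t) := fun t ht =>
    Qstar_mem_confidenceSet hR hr hc (hdev t ht)
  have hG : ∀ t < T, sel (D.take t) ∈ M.confidenceSet F β (D.take t) ∧
      M.Vstar 0 M.init ≤ sel (D.take t) 0 M.init (greedy (sel (D.take t)) 0 M.init) := fun t ht =>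
    have h1 := hsel t ht _ (hrun t ht.le)
    ⟨h1.1, Vstar_le_of_mem_confidenceSet hR hr hH hgr (hQc t ht) h1.2⟩
  have hA : ∀ t < T, M.Admissible (sel (D.take t)) := fun t ht => hadm _ (hG t ht).1.1
  set Cv := (M.coverability Pol).toReal with hCv
  have hCv1 : 1 ≤ Cv := by
    rw [hCv, ← ENNReal.toReal_one]
    exact ENNReal.toReal_mono (M.coverability_ne_top Pol)
      (M.one_le_coverability hH (hPol _ hQ))
  have hT2 : (2 : ℝ) ≤ T := by exact_mod_cast hT
  have hlog : 1 / 2 ≤ Real.log T := by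
    have h1 := Real.log_two_gt_d9
    have h2 := Real.log_le_log (by norm_num) hT2
    linarith
  have hH' : (1 : ℝ) ≤ M.H := by exact_mod_cast hH
  have hβlog : 1 ≤ β * Real.log T := by nlinarith
  set Y := √(Cv * (β * T * Real.log T)) with hY
  have hCT : Cv * T ≤ Cv * (β * T * Real.log T) := by
    have : (T : ℝ) ≤ T * (β * Real.log T) := by nlinarith
    nlinarith
  -- If `Cv ≤ T`, the burn-in cost `2 Cv` is at most `2Y`. Otherwise `T ≤ Y` and the trivial regret
  -- bound `T` suffices.
  rcases le_total Cv T with hCvT | hCvT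
  · have hCY : Cv ≤ Y := Real.le_sqrt_of_sq_le (by nlinarith)
    have hY0 : 0 < Y := by linarith
    have hYY : Y * Y = Cv * (β * T * Real.log T) := Real.mul_self_sqrt (by positivity)
    have hstep : ∀ h < M.H, ∑ t ∈ Finset.range T,
        (M.visitLaw (greedy (sel (D.take t))) h).expect (M.residual (sel (D.take t)) h) ≤
          7 * Y := fun h hh => by
      -- This `η` makes the logarithmic term `Y` and the residual term `4Y`; with the burn-in `2Y`
      -- the total is `7Y`.
      have h1 := sum_expect_residual_le (Pol := Pol) (π := fun t => greedy (sel (D.take t)))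
        (f := fun t => sel (D.take t)) (T := T) (h := h) (R := 8 * β)
        (η := Y / (Cv * Real.log T)) (by omega) (fun t ht => hPol _ (hG t ht).1.1) hA hh
        (by positivity) fun t ht => ?_
      · rw [← hCv] at h1
        have e1 : Y / (Cv * Real.log T) * (Cv * Real.log T) = Y :=
          div_mul_cancel₀ _ (by positivity)
        have e2 : T * (8 * β) / (2 * (Y / (Cv * Real.log T))) = 4 * Y := by
          rw [div_eq_iff (by positivity)]
          field_simp
          linarith
        rw [e1, e2] at h1
        linarith
      · have h1 := sum_expect_residual_sq_le hB (hG t ht).1 hh (hdev t ht _ (hG t ht).1.1 h hh)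
        rw [hlen t ht] at h1
        refine le_trans (le_of_eq (Finset.sum_congr rfl fun i hi => ?_)) (h1.trans (by linarith))
        rw [List.take_take, min_eq_left (Finset.mem_range.1 hi).le]
    calc M.regret greedy sel T D
        ≤ ∑ t ∈ Finset.range T, ∑ h ∈ Finset.range M.H,
          (M.visitLaw (greedy (sel (D.take t))) h).expect (M.residual (sel (D.take t)) h) := by
          refine Finset.sum_le_sum fun t ht => ?_
          have ht := Finset.mem_range.1 ht
          rw [← (hA t ht).sub_V_eq_sum hr (hgr _ (hG t ht).1.1)]
          linarith [(hG t ht).2]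
      _ = ∑ h ∈ Finset.range M.H, ∑ t ∈ Finset.range T,
          (M.visitLaw (greedy (sel (D.take t))) h).expect (M.residual (sel (D.take t)) h) :=
          Finset.sum_comm
      _ ≤ ∑ _h ∈ Finset.range M.H, 7 * Y :=
          Finset.sum_le_sum fun h hh => hstep h (Finset.mem_range.1 hh)
      _ = 7 * (M.H * Y) := by
          rw [Finset.sum_const, Finset.card_range, nsmul_eq_mul]
          ring
  · have hTY : (T : ℝ) ≤ Y := Real.le_sqrt_of_sq_le (by nlinarith)
    calc M.regret greedy sel T D ≤ ∑ _t ∈ Finset.range T, (1 : ℝ) := by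
          refine Finset.sum_le_sum fun t ht => ?_
          have ht := Finset.mem_range.1 ht
          have h1 := M.V_nonneg hr (greedy (sel (D.take t))) M.init
          have h2 := ((hA t ht).mem_Icc 0 M.init (greedy (sel (D.take t)) 0 M.init)).2
          linarith [(hG t ht).2]
      _ = T := by simp
      _ ≤ 7 * (M.H * Y) := by nlinarith

/-- The high-probability regret bound of GOLF in terms of coverability. -/
theorem ofReal_one_sub_le_toOuterMeasure_regret_le (hM : M.Normalized) {Pol : Set (Policy S A)}
    (hU : M.UnitRange F) (hR : M.Realizable F) (hB : M.BellmanComplete F)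
    (hgr : M.IsGreedyRule (M.classOf F) greedy) (hPol : ∀ f ∈ M.classOf F, greedy f ∈ Pol)
    {T : ℕ} (hT : 2 ≤ T) {δ : ℝ} (hδ : 0 < δ) (hδ1 : δ < 1) {N : ℕ}
    (hN : M.coveringNumber (M.classOf F) (1 / (T : ℝ)) = N)
    (hsel : M.IsGOLF F greedy (50 * Real.log (N * T * M.H / δ)) T sel) :
    ENNReal.ofReal (1 - δ) ≤ (M.runLaw greedy sel T).toOuterMeasure
      {D | M.regret greedy sel T D ≤ 7 * (M.H * √((M.coverability Pol).toReal *
        (50 * Real.log (N * T * M.H / δ) * T * Real.log T)))} := by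
  have hadm : ∀ f ∈ M.classOf F, M.Admissible f := fun f => M.admissible_of_mem_classOf hU hB
  have hQ := M.Qstar_mem_classOf hR
  obtain ⟨C, hCN, hCF, hnet⟩ := M.exists_net ⟨_, hQ⟩ hN
  have hN1 : 1 ≤ N := by
    obtain ⟨g, hg, -⟩ := hnet _ hQ
    exact (Finset.card_pos.2 ⟨g, hg⟩).trans_le hCN
  have hN1' : (1 : ℝ) ≤ N := by exact_mod_cast hN1
  have hT2 : (2 : ℝ) ≤ T := by exact_mod_cast hT
  have hH' : (1 : ℝ) ≤ M.H := by exact_mod_cast hM.horizon_pos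
  have h2 : 2 ≤ N * T * M.H / δ := by
    rw [le_div_iff₀ hδ]
    have : (2 : ℝ) ≤ N * T := by nlinarith
    nlinarith
  set ℓ := Real.log (N * T * M.H / δ) with hℓ
  have hℓ1 : 0.69 ≤ ℓ := by
    have h3 := Real.log_two_gt_d9
    have h4 := Real.log_le_log (by norm_num) h2
    linarith
  refine PMF.ofReal_one_sub_le_toOuterMeasure _ hδ.le
    ((toOuterMeasure_exists_deviation_le (fun g hg => hadm g (hCF g hg)) greedy sel T ℓ).trans
      (ENNReal.ofReal_le_ofReal ?_)) fun D hD hgood => ?_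
  -- By the choice of `ℓ`, `N T H exp(-ℓ) = δ`.
  · rw [Real.exp_neg, hℓ, Real.exp_log (by linarith), inv_div, mul_div_assoc',
      div_le_iff₀ (by positivity), mul_comm δ]
    gcongr
  · simp only [Set.mem_ofPred_eq, not_exists, not_and, not_lt] at hgood
    -- The `13/4` is the discretisation error at radius `2/T` over at most `T` episodes. The factor
    -- 50 suffices for `8c = 8ℓ + 26 ≤ 50ℓ`, as `ℓ ≥ 0.69`.
    refine regret_le_of_forall_deviation_le hM hU hR hB hgr hPol hT (c := ℓ + 13 / 4)
      (by linarith) (by linarith) hsel hD fun t ht f hf h hh => ?_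
    obtain ⟨g, hg, hfg⟩ := hnet f hf
    have hfg' : ∀ h s a, |f h s a - g h s a| ≤ 2 * (1 / (T : ℝ)) := fun h s a => by
      rcases Nat.lt_or_ge h M.H with h1 | h1
      · exact hfg h h1 s a
      · rw [hf.2 h h1, (hCF g hg).2 h h1]
        simp
    have h3 := (hadm f hf).deviation_le (hadm g (hCF g hg)) hfg' hh
      ((M.mem_support_runLaw hD).2.1 t ht.le)
    have h4 := hgood t ht h hh g hg
    have h5 : (t : ℝ) * (13 / 8 * (2 * (1 / (T : ℝ)))) ≤ 13 / 4 := by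
      have : (t : ℝ) ≤ T := by exact_mod_cast ht.le
      have h6 : (t : ℝ) / T ≤ 1 := div_le_one_of_le₀ this (by positivity)
      have h7 : (t : ℝ) * (13 / 8 * (2 * (1 / (T : ℝ)))) = 13 / 4 * (t / T) := by ring
      linarith
    linarith

end RL.EpisodicMDP

/-! ### The theorem. -/

theorem mainTheorem1 :
    ∃ c K : ℝ, 0 < c ∧ 0 < K ∧
      ∀ (S : Type u) (A : Type v) [Fintype A] [Nonempty A]
        (M : RL.EpisodicMDP S A) (_ : M.Normalized)
        (Pol : Set (RL.Policy S A)) (p : ℝ) (_ : 1 ≤ p)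
        (μ : ℕ → PMF (S × A))
        (_ : M.coverage Pol p μ = M.Ccw Pol p)
        (_ : ∀ h < M.H, ∑' x, (μ h x) ^ (1 / 2 : ℝ) ≠ ⊤),
        ∃ L : ℝ,
          (∀ B : ℝ≥0, (∀ h < M.H, ∑' x, (μ h x) ^ (min (1 / 2) (1 - 1 / p) : ℝ) ≤ B) →
            L ≤ K * √(B : ℝ)) ∧
          ∀ (F : ℕ → Set (S → A → ℝ)) (_ : M.UnitRange F)
            (_ : M.Realizable F) (_ : M.BellmanComplete F)
            (greedy : RL.QFun S A → RL.Policy S A)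
            (_ : M.IsGreedyRule (M.classOf F) greedy)
            (_ : ∀ f ∈ M.classOf F, greedy f ∈ Pol)
            (T : ℕ) (_ : 2 ≤ T) (δ : ℝ) (_ : 0 < δ) (_ : δ < 1)
            (N : ℕ) (_ : M.coveringNumber (M.classOf F) (1 / (T : ℝ)) = N)
            (β : ℝ) (_ : β = c * Real.log (N * T * M.H / δ))
            (sel : List (List (RL.Step S A)) → RL.QFun S A)
            (_ : M.IsGOLF F greedy β T sel),
            ENNReal.ofReal (1 - δ) ≤
              (M.runLaw greedy sel T).toOuterMeasure
                {D | M.regret greedy sel T D ≤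
                  L * (M.H * √((M.Ccw Pol p).toReal ^ (1 / p) * β * T * Real.log T))} := by
  refine ⟨50, 7, by norm_num, by norm_num, ?_⟩
  intro S A _ _ M hM Pol p hp μ hμ _
  have hp0 : 0 < p := by linarith
  have hCcw := M.Ccw_ne_top Pol hp0.le
  set κ := (M.Ccw Pol p).toReal ^ (1 / p) with hκ
  have hκ0 : 0 ≤ κ := by positivity
  refine ⟨7 * √((M.coverability Pol).toReal / κ), fun B hB => ?_, ?_⟩
  · have h1 := M.coverability_le_rpow_mul hp (hμ ▸ hCcw) hB
    rw [hμ] at h1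
    have h2 := ENNReal.toReal_mono (ENNReal.mul_ne_top
      (ENNReal.rpow_ne_top_of_nonneg (by positivity) hCcw) ENNReal.coe_ne_top) h1
    rw [ENNReal.toReal_mul, ← ENNReal.toReal_rpow, ENNReal.coe_toReal] at h2
    gcongr
    -- Here `κ = 0` is possible, for an empty policy class; division by zero then gives `L = 0`.
    exact div_le_of_le_mul₀ hκ0 B.2 (h2.trans_eq (mul_comm _ _))
  · intro F hU hR hB greedy hgr hPol T hT δ hδ hδ1 N hN β hβ sel hsel
    subst hβ
    -- Realizability now supplies a policy in the class, the greedy one of `Q^⋆`, so `κ` is positive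
    -- and cancels.
    have hκpos : 0 < κ := Real.rpow_pos_of_pos (ENNReal.toReal_pos
      (M.Ccw_ne_zero hM.horizon_pos hp hμ (hPol _ (M.Qstar_mem_classOf hR))) hCcw) _
    have key := RL.EpisodicMDP.ofReal_one_sub_le_toOuterMeasure_regret_le hM hU hR hB hgr hPol hT
      hδ hδ1 hN hsel
    have e : √((M.coverability Pol).toReal *
          (50 * Real.log (N * T * M.H / δ) * T * Real.log T)) =
        √((M.coverability Pol).toReal / κ) *
          √(κ * (50 * Real.log (N * T * M.H / δ)) * T * Real.log T) := by
      rw [← Real.sqrt_mul (by positivity)]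
      congr 1
      field_simp
    rw [e] at key
    refine key.trans (le_of_eq ?_)
    congr 2
    ext D
    rw [mul_left_comm (M.H : ℝ), ← mul_assoc (7 : ℝ)]
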